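/- All rings are nonzero, commutative and unital. Let $n\ge 1$. An ideal $I$ of a ring $R$ is $n$-absorbing if, whenever $a_1,\dots,a_{n+1}\in R$ and $a_1\cdots a_{n+1}\in I$, there is an $i$ with $\prod_{j\ne i}a_j\in I$. The ring $R$ is a TAF-ring if every proper ideal of $R$ is a finite product of $2$-absorbing ideals, and finite-absorbing if every proper ideal of $R$ is $n$-absorbing for some positive integer $n$ (depending on the ideal). It is strongly Laskerian if every proper ideal is a finite intersection of primary ideals and every primary ideal contains a power of its radical. A prime ideal $P$ of $R$ is strongly prime if $aP$ and $bR$ are comparable under inclusion for all $a,b\in R$; $R$ is a PVR if some maximal ideal of $R$ is strongly prime, and an LPVR if $R_M$ is a PVR for every maximal ideal $M$ of $R$. A nonunit $a\in R$ is irreducible if $a=bc$ with $b,c\in R$ implies $aR=bR$ or $aR=cR$; $R$ is atomic if every nonzero nonunit of $R$ is a finite product of irreducible elements. An integral domain $R$ with quotient field $K$ is a PVD if, for every prime ideal $P$ of $R$ and all $x,y\in K$ with $xy\in P$, we have $x\in P$ or $y\in P$; it is an LPVD if $R_M$ is a PVD for every maximal ideal $M$ of $R$. It is a Mori domain if it satisfies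 the ascending chain condition on divisorial ideals, that is, on nonzero ideals $I$ with $R:(R:I)=I$, where $A:B=\{x\in K\mid xB\subseteq A\}$. Theorem. For a ring $R$ the following are equivalent. 1. $R$ is a TAF-ring. 2. $R$ is strongly Laskerian and, for each maximal ideal $M$ of $R$, every $M$-primary ideal of $R$ is comparable to $M^2$ under inclusion. 3. $R$ is a strongly Laskerian LPVR. 4. $R$ is a finite-absorbing LPVR. 5. $R\cong R_1\times\cdots\times R_r$ for some $r\ge 1$ and rings $R_1,\dots,R_r$, each of which is an atomic PVR or a Mori LPVD. -/

import Mathlib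

open scoped nonZeroDivisors

universe u

namespace TAF

section CommutativeRings

variable {R : Type u} [CommRing R]

/-- An ideal `I` is `n`-absorbing if whenever a product of `n + 1` elements lies in `I`, the product
of some `n` of them already lies in `I`. -/
def IsNAbsorbing (n : ℕ) (I : Ideal R) : Prop :=
  ∀ a : Fin (n + 1) → R, ∏ i, a i ∈ I → ∃ i, ∏ j ∈ Finset.univ.erase i, a j ∈ I

variable (R) in
/-- Every proper ideal is `n`-absorbing for some positive integer `n`. -/
def IsFiniteAbsorbing : Prop :=
  ∀ I : Ideal R, I ≠ ⊤ → ∃ n : ℕ, 0 < n ∧ IsNAbsorbing n I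

variable (R) in
/-- Every proper ideal is a finite product of `2`-absorbing ideals. -/
def IsTAFRing : Prop :=
  ∀ I : Ideal R, I ≠ ⊤ →
    ∃ s : Multiset (Ideal R), (∀ J ∈ s, IsNAbsorbing 2 J) ∧ s.prod = I

variable (R) in
/-- Every proper ideal is a finite intersection of primary ideals, and every primary ideal contains
a power of its radical. (In `IsLasker R R` the unit ideal is the empty intersection.) -/
def IsStronglyLaskerian : Prop :=
  IsLasker R R ∧ ∀ Q : Ideal R, Q.IsPrimary → ∃ n : ℕ, Q.radical ^ n ≤ Q

/-- A prime ideal `P` of a ring is strongly prime if `aP` and `bR` are comparable for all `a`, `b`. -/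
def IsStronglyPrime (P : Ideal R) : Prop :=
  P.IsPrime ∧ ∀ a b : R,
    Ideal.span {a} * P ≤ Ideal.span {b} ∨ Ideal.span {b} ≤ Ideal.span {a} * P

variable (R) in
/-- Pseudo-valuation ring (PVR): some maximal ideal is strongly prime. -/
def IsPVR : Prop :=
  ∃ M : Ideal R, M.IsMaximal ∧ IsStronglyPrime M

variable (R) in
/-- Locally pseudo-valuation ring (LPVR): every localization at a maximal ideal is a PVR. -/
def IsLPVR : Prop :=
  ∀ (M : Ideal R) [M.IsMaximal], IsPVR (Localization.AtPrime M)

/-- A nonunit `a` is irreducible if `a = bc` implies `aR = bR` or `aR = cR`. In rings with zero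
divisors this differs from Mathlib's `Irreducible`. -/
def IsIrreducibleElt (a : R) : Prop :=
  ¬ IsUnit a ∧ ∀ b c : R, a = b * c →
    Ideal.span {a} = Ideal.span {b} ∨ Ideal.span {a} = Ideal.span {c}

variable (R) in
/-- Every nonzero nonunit is a finite product of irreducible elements. -/
def IsAtomicRing : Prop :=
  ∀ a : R, a ≠ 0 → ¬ IsUnit a →
    ∃ s : Multiset R, (∀ p ∈ s, IsIrreducibleElt p) ∧ s.prod = a

end CommutativeRings

section Domains

variable (R : Type u) [CommRing R]

/-- Pseudo-valuation domain (PVD): an integral domain with quotient field `K` such that, for every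
prime ideal `P` and all `x y : K`, `x * y ∈ P` implies `x ∈ P` or `y ∈ P`. -/
def IsPVD : Prop :=
  IsDomain R ∧ ∀ P : Ideal R, P.IsPrime → ∀ x y : FractionRing R,
    x * y ∈ algebraMap R (FractionRing R) '' P →
      x ∈ algebraMap R (FractionRing R) '' P ∨ y ∈ algebraMap R (FractionRing R) '' P

/-- Locally pseudo-valuation domain (LPVD): an integral domain all of whose localizations at maximal
ideals are PVDs. -/
def IsLPVD : Prop :=
  IsDomain R ∧ ∀ (M : Ideal R) [M.IsMaximal], IsPVD (Localization.AtPrime M)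

variable {R} in
/-- A nonzero ideal `I` of an integral domain is divisorial if `R : (R : I) = I`, the residuals being
taken in the quotient field. -/
def IsDivisorial [IsDomain R] (I : Ideal R) : Prop :=
  I ≠ ⊥ ∧ 1 / (1 / (I : FractionalIdeal R⁰ (FractionRing R))) = I

/-- Mori domain: an integral domain with the ascending chain condition on divisorial ideals. -/
def IsMoriDomain : Prop :=
  ∃ _ : IsDomain R, ∀ I : ℕ → Ideal R, Monotone I → (∀ n, IsDivisorial (I n)) →
    ∃ n, ∀ m, n ≤ m → I m = I n

end Domains

end TAF

/-! The five conditions meet in one local notion, `IsLevel`: every nonzero x satisfies x m = m^(k+1)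
for some k with x ∈ m^k. A level local ring resembles a discrete valuation ring in which x m, rather
than xR, is a power of m. Nonzero ideals contain powers of m, no primes occur besides 0 and m, and
either the ring is a domain or m is nilpotent. Each condition amounts to level localizations at all
maximal ideals together with finitely many minimal primes over every ideal.

Levelness is reached in four ways. In a local TAF-ring with m ≠ m^2, an ideal of m outside m^2 has
only one proper factor, so it is 2-absorbing, which gives m^2 ⊆ zR for every z in m outside m^2; the
case m = m^2 is settled by localizing at smaller primes (`IsTAFRing.isLevel`). In a strongly
Laskerian ring the same inclusion comes from the primary ideals rR + M^n and a Krull-type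
intersection argument (`IsStronglyLaskerian.isLevel_atPrime`). A pseudo-valuation ring whose nonzero
nonunits factor into elements that are not products of two nonunits is level
(`IsStronglyPrime.isLevel`). Such factorizations come from atomicity, from a bound on factorization
lengths when the ring is finite-absorbing, and from the chain condition in the Mori case.

Conversely, in a ring with level localizations the isolated components of an ideal at its minimal
primes are primary, pairwise comaximal, and intersect in the ideal. With finitely many of them the
ring is strongly Laskerian, and factoring each component locally shows that it is a TAF-ring.
Applied to the zero ideal, the Chinese remainder theorem splits the ring: maximal minimal primes
give level local rings, the others give domains. Such a domain is Mori because each nonzero ideal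
has the same residuals as a finite subset (`IsLocallyLevel.exists_finset`). -/

namespace TAF

/-! ### Absorbing ideals: factors, intersections, radicals, minimal primes, localization. -/

section Absorbing

variable {R : Type*} [CommRing R]

/-- The multiset form of the `n`-absorbing condition. -/
lemma IsNAbsorbing.exists_cons {n : ℕ} {I : Ideal R} (h : IsNAbsorbing n I) (s : Multiset R)
    (hs : s.card = n + 1) (hI : s.prod ∈ I) : ∃ a t, s = a ::ₘ t ∧ t.prod ∈ I := by
  obtain ⟨l, rfl⟩ := Quot.exists_rep s
  have hl : l.length = n + 1 := hs
  let f : Fin (n + 1) → R := fun i => l.get (i.cast hl.symm)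
  have hf : (Finset.univ.val.map f : Multiset R) = (l : Multiset R) := by
    rw [Fin.univ_val_map]
    congr 1
    apply List.ext_get
    · simp [hl]
    · intro i h1 h2
      rw [List.get_eq_getElem, List.get_eq_getElem, List.getElem_ofFn]
      simp [f]
  obtain ⟨i, hi⟩ := h f (by
    have : ∏ i, f i = (l : Multiset R).prod := by rw [← hf]; rfl
    rw [this]; exact hI)
  refine ⟨f i, (Finset.univ.erase i).val.map f, ?_, hi⟩
  change (l : Multiset R) = _
  rw [← hf, ← Multiset.map_cons]
  congr 1
  rw [Finset.erase_val]
  exact (Multiset.cons_erase (Finset.mem_univ i)).symm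

lemma IsNAbsorbing.of_exists_cons {n : ℕ} {I : Ideal R}
    (h : ∀ s : Multiset R, s.card = n + 1 → s.prod ∈ I → ∃ a t, s = a ::ₘ t ∧ t.prod ∈ I) :
    IsNAbsorbing n I := by
  intro f hf
  obtain ⟨a, t, hst, ht⟩ := h (Finset.univ.val.map f) (by simp) hf
  have ha : a ∈ Finset.univ.val.map f := by rw [hst]; exact Multiset.mem_cons_self a t
  obtain ⟨i, -, rfl⟩ := Multiset.mem_map.mp ha
  refine ⟨i, ?_⟩
  have : (Finset.univ.erase i).val.map f = t := by
    rw [← Multiset.cons_inj_right (f i), ← hst, ← Multiset.map_cons, Finset.erase_val]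
    congr 1
    exact Multiset.cons_erase (Finset.mem_univ i)
  change ((Finset.univ.erase i).val.map f).prod ∈ I
  rwa [this]

lemma isNAbsorbing_two_iff {I : Ideal R} : IsNAbsorbing 2 I ↔
    ∀ a b c : R, a * b * c ∈ I → a * b ∈ I ∨ a * c ∈ I ∨ b * c ∈ I := by
  constructor
  · intro h a b c habc
    obtain ⟨i, hi⟩ := h ![a, b, c] (by simpa [Fin.prod_univ_three] using habc)
    fin_cases i
    · have : (Finset.univ.erase 0 : Finset (Fin 3)) = {1, 2} := by decide
      right; right; simpa [this] using hi
    · have : (Finset.univ.erase 1 : Finset (Fin 3)) = {0, 2} := by decide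
      right; left; simpa [this] using hi
    · have : (Finset.univ.erase 2 : Finset (Fin 3)) = {0, 1} := by decide
      left; simpa [this] using hi
  · intro h
    refine .of_exists_cons fun s hs hI => ?_
    obtain ⟨a, b, c, rfl⟩ := Multiset.card_eq_three.mp hs
    have := h a b c (by simpa [mul_assoc] using hI)
    rcases this with h1 | h1 | h1
    · refine ⟨c, {a, b}, ?_, by simpa using h1⟩
      simp only [Multiset.insert_eq_cons]
      rw [Multiset.cons_swap c a, ← Multiset.singleton_add b, ← Multiset.singleton_add c, add_comm]
    · refine ⟨b, {a, c}, ?_, by simpa using h1⟩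
      simp only [Multiset.insert_eq_cons]
      rw [Multiset.cons_swap]
    · exact ⟨a, {b, c}, rfl, by simpa using h1⟩

lemma IsNAbsorbing.succ {n : ℕ} {I : Ideal R} (h : IsNAbsorbing n I) : IsNAbsorbing (n + 1) I := by
  classical
  refine .of_exists_cons fun s hs hI => ?_
  obtain ⟨x, s, rfl⟩ := Multiset.exists_mem_of_ne_zero (s := s) (by rintro rfl; simp at hs) |>.imp
    fun x hx => Multiset.exists_cons_of_mem hx
  obtain ⟨y, s, rfl⟩ := Multiset.exists_mem_of_ne_zero (s := s) (by rintro rfl; simp at hs)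
    |>.imp fun x hx => Multiset.exists_cons_of_mem hx
  obtain ⟨a, t, hst, ht⟩ := h.exists_cons ((x * y) ::ₘ s) (by simpa using hs)
    (by simpa [mul_assoc] using hI)
  rcases Multiset.cons_eq_cons.mp hst with ⟨-, rfl⟩ | ⟨-, u, rfl, rfl⟩
  · exact ⟨x, y ::ₘ s, rfl, by simpa using I.mul_mem_left y ht⟩
  · refine ⟨a, x ::ₘ y ::ₘ u, ?_, by simpa [mul_assoc] using ht⟩
    rw [Multiset.cons_swap y a, Multiset.cons_swap x a]

lemma IsNAbsorbing.mono {n m : ℕ} {I : Ideal R} (h : IsNAbsorbing n I) (hm : n ≤ m) : IsNAbsorbing m I := by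
  induction m, hm using Nat.le_induction with
  | base => exact h
  | succ k hk ih => exact ih.succ

lemma IsNAbsorbing.exists_le {n : ℕ} {I : Ideal R} (h : IsNAbsorbing n I) (s : Multiset R)
    (hI : s.prod ∈ I) : ∃ t ≤ s, t.card ≤ n ∧ t.prod ∈ I := by
  induction hs : s.card generalizing s with
  | zero => exact ⟨s, le_rfl, by lia, hI⟩
  | succ k ih =>
    rcases le_or_gt (k + 1) n with hk | hk
    · exact ⟨s, le_rfl, by lia, hI⟩
    obtain ⟨a, t, rfl, ht⟩ := (h.mono (Nat.lt_succ_iff.mp hk)).exists_cons s hs hI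
    obtain ⟨v, hv, h1, h2⟩ := ih t ht (by simpa using hs)
    exact ⟨v, hv.trans (Multiset.le_cons_self t a), h1, h2⟩

lemma prod_mem_of_le {I : Ideal R} {s t : Multiset R} (h : s ≤ t) (hs : s.prod ∈ I) :
    t.prod ∈ I := I.mem_of_dvd (Multiset.prod_dvd_prod_of_le h) hs

/-- The short subproducts for I and J use together at most n + m of the n + m + 1 factors, so some
factor is in neither. The multiset union is used because, unlike the sum, it stays below s. -/
lemma IsNAbsorbing.inf {n m : ℕ} {I J : Ideal R} (hI : IsNAbsorbing n I)
    (hJ : IsNAbsorbing m J) : IsNAbsorbing (n + m) (I ⊓ J) := by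
  classical
  refine .of_exists_cons fun s hs h => ?_
  obtain ⟨t, hts, htc, ht⟩ := hI.exists_le s h.1
  obtain ⟨v, hvs, hvc, hv⟩ := hJ.exists_le s h.2
  have hlt : t ∪ v < s := by
    refine lt_of_le_of_ne (Multiset.union_le hts hvs) fun heq => ?_
    have : (t ∪ v).card ≤ t.card + v.card := by
      rw [← Multiset.card_add]; exact Multiset.card_le_card (Multiset.union_le_add t v)
    rw [heq] at this
    lia
  obtain ⟨a, ha⟩ := Multiset.lt_iff_cons_le.mp hlt
  obtain ⟨w, hw⟩ := Multiset.exists_cons_of_mem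
    (Multiset.mem_of_le ha (Multiset.mem_cons_self a _))
  rw [hw, Multiset.cons_le_cons_iff] at ha
  exact ⟨a, w, hw, prod_mem_of_le ((Multiset.le_union_left).trans ha) ht,
    prod_mem_of_le ((Multiset.le_union_right).trans ha) hv⟩

lemma exists_isNAbsorbing_finsetInf (s : Finset (Ideal R))
    (h : ∀ I ∈ s, ∃ n, 0 < n ∧ IsNAbsorbing n I) : ∃ n, 0 < n ∧ IsNAbsorbing n (s.inf id) := by
  classical
  induction s using Finset.induction_on with
  | empty => exact ⟨1, one_pos, fun a _ => ⟨0, by simp⟩⟩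
  | insert I s hI ih =>
    obtain ⟨n, hn, h1⟩ := h I (Finset.mem_insert_self I s)
    obtain ⟨m, hm, h2⟩ := ih fun J hJ => h J (Finset.mem_insert_of_mem hJ)
    rw [Finset.inf_insert]
    exact ⟨n + m, by lia, h1.inf h2⟩

lemma multiset_prod_mem_pow {I : Ideal R} (t : Multiset R) (h : ∀ x ∈ t, x ∈ I) :
    t.prod ∈ I ^ t.card := by
  induction t using Multiset.induction_on with
  | empty => simp
  | cons a t ih =>
    rw [Multiset.prod_cons, Multiset.card_cons, pow_succ']
    exact Ideal.mul_mem_mul (h a (Multiset.mem_cons_self a t))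
      (ih fun x hx => h x (Multiset.mem_cons_of_mem hx))

/-- A primary ideal containing a power of its radical is finite-absorbing. -/
lemma exists_isNAbsorbing_of_isPrimary {Q : Ideal R} (hQ : Q.IsPrimary) {n : ℕ}
    (hn : Q.radical ^ n ≤ Q) : ∃ n, 0 < n ∧ IsNAbsorbing n Q := by
  refine ⟨n + 1, n.succ_pos, .of_exists_cons fun s hs h => ?_⟩
  rw [Ideal.isPrimary_iff] at hQ
  by_cases hall : ∀ x ∈ s, x ∈ Q.radical
  · obtain ⟨a, t, rfl⟩ := Multiset.exists_mem_of_ne_zero (s := s) (by rintro rfl; simp at hs)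
      |>.imp fun x hx => Multiset.exists_cons_of_mem hx
    refine ⟨a, t, rfl, hn ?_⟩
    have htc : t.card = n + 1 := by simpa using hs
    have : t.prod ∈ Q.radical ^ (n + 1) := by
      rw [← htc]
      exact multiset_prod_mem_pow t fun x hx => hall x (Multiset.mem_cons_of_mem hx)
    exact Ideal.pow_le_pow_right n.le_succ this
  · push Not at hall
    obtain ⟨a, has, ha⟩ := hall
    obtain ⟨t, rfl⟩ := Multiset.exists_cons_of_mem has
    refine ⟨a, t, rfl, ?_⟩
    rw [Multiset.prod_cons, mul_comm] at h
    exact (hQ.2 h).resolve_right ha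

lemma IsStronglyLaskerian.isFiniteAbsorbing (h : IsStronglyLaskerian R) : IsFiniteAbsorbing R := by
  intro I hI
  obtain ⟨s, rfl, hs⟩ := h.1 I
  refine exists_isNAbsorbing_finsetInf s fun Q hQ => ?_
  obtain ⟨n, hn⟩ := h.2 Q (hs hQ)
  exact exists_isNAbsorbing_of_isPrimary (hs hQ) hn

/-- The square of the radical of a `2`-absorbing ideal is contained in the ideal. -/
lemma IsNAbsorbing.sq_mem {J : Ideal R} (h : IsNAbsorbing 2 J) {x : R} (hx : x ∈ J.radical) :
    x ^ 2 ∈ J := by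
  obtain ⟨n, hn⟩ := hx
  obtain ⟨t, ht, htc, htp⟩ := h.exists_le (Multiset.replicate n x) (by simpa using hn)
  obtain ⟨k, hk, rfl⟩ := Multiset.le_replicate_iff.mp ht
  rw [Multiset.prod_replicate] at htp
  exact J.mem_of_dvd (pow_dvd_pow x (by simpa using htc)) htp

lemma IsNAbsorbing.radical_sq_le {J : Ideal R} (h : IsNAbsorbing 2 J) : J.radical ^ 2 ≤ J := by
  rw [pow_two, Ideal.mul_le]
  intro x hx y hy
  have hx2 := h.sq_mem hx
  have hy2 := h.sq_mem hy
  -- The product x y (x + y) is a combination of x^2 and y^2, and each of the three possible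
  -- conclusions is x y up to one of these squares.
  have := isNAbsorbing_two_iff.mp h x y (x + y) (by
    have : x * y * (x + y) = y * x ^ 2 + x * y ^ 2 := by ring
    rw [this]
    exact J.add_mem (J.mul_mem_left _ hx2) (J.mul_mem_left _ hy2))
  rcases this with h1 | h1 | h1
  · exact h1
  · have : x * y = x * (x + y) - x ^ 2 := by ring
    rw [this]; exact J.sub_mem h1 hx2
  · have : x * y = y * (x + y) - y ^ 2 := by ring
    rw [this]; exact J.sub_mem h1 hy2

/-- Such a J is M-primary: a factor outside M can be cancelled, and two factors inside M already
have their product in M^2. -/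
lemma isNAbsorbing_two_of_sq_le {M J : Ideal R} [hM : M.IsMaximal] (h1 : M ^ 2 ≤ J) (h2 : J ≤ M) :
    IsNAbsorbing 2 J := by
  have hJ : J.radical = M := le_antisymm
    ((Ideal.radical_mono h2).trans hM.isPrime.radical.le) (fun x hx => ⟨2, h1 (Ideal.pow_mem_pow hx 2)⟩)
  have hprim : J.IsPrimary := Ideal.isPrimary_of_isMaximal_radical (hJ ▸ hM)
  rw [Ideal.isPrimary_iff, hJ] at hprim
  rw [isNAbsorbing_two_iff]
  intro a b c h
  by_cases hc : c ∈ M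
  · by_cases hb : b ∈ M
    · right; right
      exact h1 (by rw [pow_two]; exact Ideal.mul_mem_mul hb hc)
    · right; left
      exact (hprim.2 (x := a * c) (y := b) (by convert h using 1; ring)).resolve_right hb
  · left
    exact (hprim.2 h).resolve_right hc

lemma isNAbsorbing_two_of_isPrime {P : Ideal R} (hP : P.IsPrime) : IsNAbsorbing 2 P := by
  rw [isNAbsorbing_two_iff]
  intro a b c h
  rcases hP.mem_or_mem h with h | h
  · exact .inl h
  · exact .inr (.inl (P.mul_mem_left a h))

lemma exists_mem_not_mem_of_incomparable {ι : Type*} [Finite ι] (P : ι → Ideal R)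
    (hP : ∀ i, (P i).IsPrime) (hinc : ∀ i j, P i ≤ P j → i = j) (i : ι) :
    ∃ x ∈ P i, ∀ j, j ≠ i → x ∉ P j := by
  classical
  have := Fintype.ofFinite ι
  by_contra! hcon
  have hsub : (P i : Set R) ⊆ ⋃ j ∈ ((Finset.univ.erase i : Finset ι) : Set ι), (P j : Set R) := by
    intro x hx
    obtain ⟨j, hj, hxj⟩ := hcon x hx
    simp only [Set.mem_iUnion]
    exact ⟨j, by simpa using hj, hxj⟩
  obtain ⟨j, hj, hij⟩ := (Ideal.subset_union_prime i i (fun j _ _ _ => hP j)).mp hsub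
  exact (Finset.ne_of_mem_erase hj) (hinc i j hij).symm

/-- An `n`-absorbing ideal has no `n + 1` distinct minimal primes. -/
lemma IsNAbsorbing.not_injective_minimalPrimes {n : ℕ} {I : Ideal R} (h : IsNAbsorbing n I)
    (P : Fin (n + 1) → Ideal R) (hP : ∀ i, P i ∈ I.minimalPrimes) : ¬ Function.Injective P := by
  intro hinj
  have hprime : ∀ i, (P i).IsPrime := fun i => (hP i).1.1
  have hinc : ∀ i j, P i ≤ P j → i = j := fun i j hij =>
    hinj (le_antisymm hij ((hP j).2 (hP i).1 hij))
  choose x hx hxn using exists_mem_not_mem_of_incomparable P hprime hinc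
  let T : Submonoid R := ⨅ i, (P i).primeCompl
  have hT : ∀ t, t ∈ T ↔ ∀ i, t ∉ P i := fun t => by
    simp [T, Submonoid.mem_iInf, Ideal.mem_primeCompl_iff]
  -- If these were disjoint, a prime p containing I would avoid both T and the product of the x i.
  -- Avoiding T puts p inside some P j, so minimality gives P j ≤ p, yet x j ∈ P j divides that
  -- product.
  have hnd : ¬ Disjoint (I : Set R) (T ⊔ Submonoid.powers (∏ i, x i) : Submonoid R) := by
    intro hdis
    obtain ⟨p, hp, hIp, hpd⟩ := Ideal.exists_le_prime_disjoint I _ hdis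
    have hsub : (p : Set R) ⊆ ⋃ j ∈ ((Finset.univ : Finset (Fin (n + 1))) : Set _),
        (P j : Set R) := by
      intro y hy
      by_contra hcon
      simp only [Finset.coe_univ, Set.mem_univ, Set.iUnion_true, Set.mem_iUnion, not_exists] at hcon
      exact Set.disjoint_left.mp hpd hy
        ((le_sup_left : T ≤ T ⊔ Submonoid.powers (∏ i, x i)) ((hT y).mpr hcon))
    obtain ⟨j, -, hj⟩ := (Ideal.subset_union_prime 0 0 (fun j _ _ _ => hprime j)).mp hsub
    have : P j ≤ p := (hP j).2 ⟨hp, hIp⟩ hj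
    exact Set.disjoint_left.mp hpd (this ((P j).mem_of_dvd (Finset.dvd_prod_of_mem x
      (Finset.mem_univ j)) (hx j)))
      ((le_sup_right : _ ≤ T ⊔ Submonoid.powers (∏ i, x i)) (Submonoid.mem_powers _))
  rw [Set.not_disjoint_iff] at hnd
  obtain ⟨y, hyI, hy⟩ := hnd
  obtain ⟨t, ht, z, ⟨N, rfl⟩, rfl⟩ := Submonoid.mem_sup.mp hy
  rw [hT] at ht
  -- The factor t is merged into one of the powers so that exactly n + 1 factors remain. A
  -- subproduct omitting index i cannot lie in P i, since t and all x j with j ≠ i are outside P i.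
  let a : Fin (n + 1) → R := fun i => if i = 0 then t * x i ^ N else x i ^ N
  have ha : ∏ i, a i = t * (∏ i, x i) ^ N := by
    have : ∀ i, a i = (if i = 0 then t else 1) * x i ^ N := fun i => by
      simp only [a]; split_ifs <;> simp
    simp only [this, Finset.prod_mul_distrib, Finset.prod_pow, Finset.prod_ite_eq',
      Finset.mem_univ, if_true]
  obtain ⟨i, hi⟩ := h a (ha ▸ hyI)
  have := hprime i
  obtain ⟨j, hj, hji⟩ := (Ideal.IsPrime.prod_mem_iff (p := P i)).mp ((hP i).1.2 hi)
  have hji' : x j ∉ P i := hxn j i (Finset.ne_of_mem_erase hj).symm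
  simp only [a] at hji
  split_ifs at hji
  · rcases (hprime i).mem_or_mem hji with h | h
    · exact ht i h
    · exact hji' ((hprime i).mem_of_pow_mem _ h)
  · exact hji' ((hprime i).mem_of_pow_mem _ hji)

lemma IsNAbsorbing.finite_minimalPrimes {n : ℕ} {I : Ideal R} (h : IsNAbsorbing n I) :
    I.minimalPrimes.Finite := by
  by_contra hinf
  have : Infinite I.minimalPrimes := Set.infinite_coe_iff.mpr hinf
  let e : Fin (n + 1) ↪ I.minimalPrimes := (Fin.valEmbedding).trans (Infinite.natEmbedding _)
  exact h.not_injective_minimalPrimes (fun i => (e i).1) (fun i => (e i).2)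
    (Subtype.val_injective.comp e.injective)

lemma IsNAbsorbing.of_comap_atPrime {M : Ideal R} [M.IsPrime] {n : ℕ}
    {I : Ideal (Localization.AtPrime M)}
    (h : IsNAbsorbing n (I.comap (algebraMap R (Localization.AtPrime M)))) : IsNAbsorbing n I := by
  intro a ha
  have : ∀ i, ∃ r : R, Associated (a i) (algebraMap R (Localization.AtPrime M) r) := fun i => by
    obtain ⟨⟨r, s⟩, hrs⟩ := IsLocalization.surj M.primeCompl (a i)
    exact ⟨r, (IsLocalization.map_units _ s).unit, hrs⟩
  choose r hr using this
  have hI : ∀ x y : Localization.AtPrime M, Associated x y → (x ∈ I ↔ y ∈ I) := fun x y hxy =>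
    ⟨fun h => I.mem_of_dvd hxy.dvd h, fun h => I.mem_of_dvd hxy.dvd' h⟩
  obtain ⟨i, hi⟩ := h r (by
    rw [Ideal.mem_comap, map_prod]
    exact (hI _ _ (Associated.prod _ _ _ fun i _ => hr i)).mp ha)
  refine ⟨i, ?_⟩
  rw [Ideal.mem_comap, map_prod] at hi
  exact (hI _ _ (Associated.prod _ _ _ fun i _ => hr i)).mpr hi

lemma IsNAbsorbing.map_atPrime {M : Ideal R} [M.IsPrime] {J : Ideal R} (h : IsNAbsorbing 2 J) :
    IsNAbsorbing 2 (J.map (algebraMap R (Localization.AtPrime M))) := by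
  set f := algebraMap R (Localization.AtPrime M)
  rw [isNAbsorbing_two_iff] at h
  have key : ∀ u : R, u ∉ M → IsUnit (f u) := fun u hu =>
    IsLocalization.map_units (Localization.AtPrime M) (⟨u, hu⟩ : M.primeCompl)
  have hmem : ∀ r : R, f r ∈ J.map f → ∃ u, u ∉ M ∧ u * r ∈ J := fun r hr => by
    obtain ⟨u, hu, h1⟩ := (IsLocalization.algebraMap_mem_map_algebraMap_iff M.primeCompl _ J r).mp hr
    exact ⟨u, hu, h1⟩
  have hI : ∀ x y : Localization.AtPrime M, Associated x y → (x ∈ J.map f ↔ y ∈ J.map f) :=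
    fun x y hxy => ⟨fun h => Ideal.mem_of_dvd _ hxy.dvd h, fun h => Ideal.mem_of_dvd _ hxy.dvd' h⟩
  have hass : ∀ a : Localization.AtPrime M, ∃ r : R, Associated a (f r) := fun a => by
    obtain ⟨⟨r, s⟩, hrs⟩ := IsLocalization.surj M.primeCompl a
    exact ⟨r, (IsLocalization.map_units _ s).unit, hrs⟩
  rw [isNAbsorbing_two_iff]
  intro a b c habc
  obtain ⟨x, hx⟩ := hass a
  obtain ⟨y, hy⟩ := hass b
  obtain ⟨z, hz⟩ := hass c
  rw [hI _ _ ((hx.mul_mul hy).mul_mul hz), ← map_mul, ← map_mul] at habc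
  rw [hI _ _ (hx.mul_mul hy), hI _ _ (hx.mul_mul hz), hI _ _ (hy.mul_mul hz)]
  obtain ⟨u, hu, hux⟩ := hmem _ habc
  -- The denominator u becomes a unit, so it can be absorbed into the first factor without changing
  -- any membership.
  have hxu : Associated (f x) (f (u * x)) := by
    rw [map_mul]; exact associated_unit_mul_right (f x) (f u) (key u hu)
  rw [hI _ _ (hxu.mul_right _), hI _ _ (hxu.mul_right (f z)), ← map_mul, ← map_mul, ← map_mul]
  rcases h (u * x) y z (by simpa [mul_assoc] using hux) with h | h | h
  · exact .inl (Ideal.mem_map_of_mem f h)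
  · exact .inr (.inl (Ideal.mem_map_of_mem f h))
  · exact .inr (.inr (Ideal.mem_map_of_mem f h))

end Absorbing

/-! ### Level local rings. -/

section Local

open IsLocalRing Ideal

variable {R : Type*} [CommRing R] [IsLocalRing R]

variable (R) in
/-- A local ring is level if every nonzero element `x` lies in some power `m ^ k` of the maximal
ideal such that `x * m = m ^ (k + 1)`. -/
def IsLevel : Prop :=
  ∀ x : R, x ≠ 0 → ∃ k : ℕ, x ∈ maximalIdeal R ^ k ∧
    span {x} * maximalIdeal R = maximalIdeal R ^ (k + 1)

/-- Nakayama for a principal ideal: x (1 - z) = 0 with 1 - z a unit. This makes the relation y ∈ x m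
irreflexive on nonzero elements. -/
lemma eq_zero_of_mem_span_mul {x : R} (h : x ∈ span {x} * maximalIdeal R) : x = 0 := by
  obtain ⟨z, hz, hxz⟩ := mem_span_singleton_mul.mp h
  have hu : IsUnit (1 - z) := isUnit_one_sub_self_of_mem_nonunits z ((mem_maximalIdeal z).mp hz)
  refine hu.mul_left_eq_zero.mp ?_
  rw [mul_sub, hxz, mul_one, sub_self]

lemma mem_of_mem_sup_span_mul {z a : R} {I : Ideal R} (hz : z ∈ maximalIdeal R)
    (h : a ∈ I ⊔ span {a * z}) : a ∈ I := by
  obtain ⟨i, hi, y, hy, hiy⟩ := Submodule.mem_sup.mp h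
  obtain ⟨r, rfl⟩ := mem_span_singleton'.mp hy
  have hu : IsUnit (1 - r * z) := isUnit_one_sub_self_of_mem_nonunits _
    ((mem_maximalIdeal _).mp (mul_mem_left _ r hz))
  have : a * (1 - r * z) = i := by rw [← sub_eq_zero]; linear_combination hiy.symm
  exact (mul_unit_mem_iff_mem I hu).mp (this ▸ hi)

lemma span_pow_mul_maximalIdeal {y : R}
    (h : span {y} * maximalIdeal R = maximalIdeal R ^ 2) (j : ℕ) :
    span {y ^ j} * maximalIdeal R = maximalIdeal R ^ (j + 1) := by
  induction j with
  | zero => simp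
  | succ j ih =>
    rw [pow_succ', ← span_singleton_mul_span_singleton, mul_assoc, ih, pow_succ' _ j, ← mul_assoc,
      h, ← pow_add]
    congr 1; lia

/-- In a local ring, if `m ^ 2 ≤ y R` for some `y` outside `m ^ 2`, then `m ^ 2 = y m`. -/
lemma span_mul_maximalIdeal_eq_sq {y : R} (hy : y ∈ maximalIdeal R)
    (hy2 : y ∉ maximalIdeal R ^ 2) (h : maximalIdeal R ^ 2 ≤ span {y}) :
    span {y} * maximalIdeal R = maximalIdeal R ^ 2 := by
  refine le_antisymm ?_ fun x hx => ?_
  · rw [pow_two]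
    exact Ideal.mul_mono_left ((span_singleton_le_iff_mem _).mpr hy)
  · obtain ⟨r, rfl⟩ := mem_span_singleton'.mp (h hx)
    rw [mul_comm r y]
    refine mul_mem_mul (mem_span_singleton_self y) ?_
    by_contra hr
    exact hy2 ((unit_mul_mem_iff_mem _ (notMem_maximalIdeal.mp hr)).mp hx)

lemma pow_succ_eq_of_eq_sq (h : maximalIdeal R = maximalIdeal R ^ 2) (k : ℕ) :
    maximalIdeal R ^ (k + 1) = maximalIdeal R := by
  induction k with
  | zero => simp
  | succ k ih => rw [pow_succ, ih, ← pow_two, ← h]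

/-- For y in m outside m^2, m^k = y^(k-1) m when k > 0, so x = y^(k-1) z with z in m outside m^2. As
z m = m^2 as well, x m = y^(k-1) m^2. -/
lemma span_mul_eq_of_sq_le (ha : ∀ y ∈ maximalIdeal R, y ∉ maximalIdeal R ^ 2 →
      maximalIdeal R ^ 2 ≤ span {y}) {x : R} {k : ℕ} (hxk : x ∈ maximalIdeal R ^ k)
    (hxk1 : x ∉ maximalIdeal R ^ (k + 1)) :
    span {x} * maximalIdeal R = maximalIdeal R ^ (k + 1) := by
  rcases k with _ | k
  · have hu : IsUnit x := by
      rw [← notMem_maximalIdeal]; simpa using hxk1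
    rw [span_singleton_eq_top.mpr hu, top_mul, zero_add, pow_one]
  obtain ⟨y, hy, hy2⟩ : ∃ y ∈ maximalIdeal R, y ∉ maximalIdeal R ^ 2 := by
    by_contra! h
    have heq : maximalIdeal R = maximalIdeal R ^ 2 := le_antisymm h (pow_le_self two_ne_zero)
    rw [pow_succ_eq_of_eq_sq heq] at hxk hxk1
    exact hxk1 hxk
  have hym := span_mul_maximalIdeal_eq_sq hy hy2 (ha y hy hy2)
  rw [← span_pow_mul_maximalIdeal hym k] at hxk
  obtain ⟨z, hz, rfl⟩ := mem_span_singleton_mul.mp hxk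
  have hz2 : z ∉ maximalIdeal R ^ 2 := fun h => hxk1 (by
    rw [show k + 1 + 1 = k + 2 by rfl, pow_add]
    exact mul_mem_mul (pow_mem_pow hy k) h)
  rw [← span_singleton_mul_span_singleton, mul_assoc,
    span_mul_maximalIdeal_eq_sq hz hz2 (ha z hz hz2), pow_two, ← mul_assoc,
    span_pow_mul_maximalIdeal hym, ← pow_succ]

lemma exists_mem_pow_notMem_pow_succ {x : R} (hx : ∃ n, x ∉ maximalIdeal R ^ n) :
    ∃ k, x ∈ maximalIdeal R ^ k ∧ x ∉ maximalIdeal R ^ (k + 1) := by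
  by_contra! h
  obtain ⟨n, hn⟩ := hx
  exact hn (Nat.rec (by simp) (fun k hk => h k hk) n)

lemma IsLevel.of_sq_le (ha : ∀ y ∈ maximalIdeal R, y ∉ maximalIdeal R ^ 2 →
      maximalIdeal R ^ 2 ≤ span {y})
    (hb : ∀ x : R, (∀ n, x ∈ maximalIdeal R ^ n) → x = 0) : IsLevel R := by
  intro x hx
  obtain ⟨k, hk, hk1⟩ := exists_mem_pow_notMem_pow_succ (x := x) (by
    by_contra! h
    exact hx (hb x h))
  exact ⟨k, hk, span_mul_eq_of_sq_le ha hk hk1⟩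

lemma notMem_pow_succ {x : R} (hx : x ≠ 0) {k : ℕ}
    (h : span {x} * maximalIdeal R = maximalIdeal R ^ (k + 1)) : x ∉ maximalIdeal R ^ (k + 1) :=
  fun hk => hx (eq_zero_of_mem_span_mul (h ▸ hk))

lemma IsLevel.eq_zero_of_forall_mem_pow (h : IsLevel R) {x : R}
    (hx : ∀ n, x ∈ maximalIdeal R ^ n) : x = 0 := by
  by_contra h0
  obtain ⟨k, -, hk⟩ := h x h0
  exact notMem_pow_succ h0 hk (hx _)

/-- The level of an element is determined by the powers of the maximal ideal containing it. -/
lemma IsLevel.span_mul_eq (h : IsLevel R) {x : R} {k : ℕ} (hx : x ∈ maximalIdeal R ^ k)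
    (hx1 : x ∉ maximalIdeal R ^ (k + 1)) :
    span {x} * maximalIdeal R = maximalIdeal R ^ (k + 1) := by
  have h0 : x ≠ 0 := by rintro rfl; exact hx1 (zero_mem _)
  obtain ⟨l, hl, hl1⟩ := h x h0
  have h1 : l ≤ k := by
    by_contra! hlt
    exact hx1 (pow_le_pow_right hlt hl)
  have h2 : k ≤ l := by
    by_contra! hlt
    exact notMem_pow_succ h0 hl1 (pow_le_pow_right hlt hx)
  rwa [le_antisymm h1 h2] at hl1

/-- The exponents decide: if k < l then b ∈ m^l ⊆ a m, and otherwise a m = m^(k+1) ⊆ m^(l+1) = b m.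
-/
lemma IsLevel.isStronglyPrime (h : IsLevel R) : IsStronglyPrime (maximalIdeal R) := by
  refine ⟨inferInstance, fun a b => ?_⟩
  by_cases ha : a = 0
  · left; simp [ha]
  by_cases hb : b = 0
  · right; simp [hb]
  obtain ⟨k, -, hk⟩ := h a ha
  obtain ⟨l, hbl, hl⟩ := h b hb
  rw [hk]
  rcases lt_or_ge k l with hkl | hkl
  · right
    rw [span_singleton_le_iff_mem]
    exact pow_le_pow_right hkl hbl
  · left
    exact (pow_le_pow_right (by lia : l + 1 ≤ k + 1)).trans (hl ▸ mul_le_left)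

lemma IsLevel.isPVR (h : IsLevel R) : IsPVR R :=
  ⟨maximalIdeal R, inferInstance, h.isStronglyPrime⟩

/-- In a nontrivial factorization both factors are nonunits, so each lies outside a smaller power of
m than the product does. This bounds the splitting process. -/
lemma IsLevel.isAtomicRing (h : IsLevel R) : IsAtomicRing R := by
  have key : ∀ k : ℕ, ∀ a : R, a ∉ maximalIdeal R ^ (k + 1) → ¬ IsUnit a →
      ∃ s : Multiset R, (∀ p ∈ s, IsIrreducibleElt p) ∧ s.prod = a := by
    intro k
    induction k with
    | zero =>
      intro a ha hu
      exact absurd (by simpa using ha) (not_not.mpr hu)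
    | succ k ih =>
      intro a ha hu
      by_cases hirr : IsIrreducibleElt a
      · exact ⟨{a}, by simpa using hirr, by simp⟩
      unfold IsIrreducibleElt at hirr
      push Not at hirr
      obtain ⟨b, c, rfl, hb, hc⟩ := hirr hu
      have hcu : ¬ IsUnit c := fun hcu => hb (span_singleton_mul_right_unit hcu b)
      have hbu : ¬ IsUnit b := fun hbu => hc (span_singleton_mul_left_unit hbu c)
      obtain ⟨s, hs, rfl⟩ := ih b (fun hbk => ha (by
        rw [pow_succ]; exact mul_mem_mul hbk ((mem_maximalIdeal c).mpr hcu))) hbu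
      obtain ⟨t, ht, rfl⟩ := ih c (fun hck => ha (by
        rw [pow_succ']; exact mul_mem_mul ((mem_maximalIdeal _).mpr hbu) hck)) hcu
      refine ⟨s + t, fun p hp => ?_, by simp⟩
      rcases Multiset.mem_add.mp hp with hp | hp
      exacts [hs p hp, ht p hp]
  intro a ha hu
  obtain ⟨k, -, hk⟩ := h a ha
  exact key k a (notMem_pow_succ ha hk) hu

/-- If a b = 0 with a, b nonzero of exponents k and l, then m^(k+1+l) = a m m^l = a b m = 0. -/
lemma IsLevel.isDomain_or (h : IsLevel R) : IsDomain R ∨ ∃ n, maximalIdeal R ^ n = ⊥ := by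
  by_cases hn : ∃ n, maximalIdeal R ^ n = ⊥
  · exact .inr hn
  left
  have : NoZeroDivisors R := ⟨fun {a b} hab => by
    by_contra! h0
    obtain ⟨k, -, hk⟩ := h a h0.1
    obtain ⟨l, -, hl⟩ := h b h0.2
    refine hn ⟨k + 1 + l, ?_⟩
    rw [pow_add, ← hk, mul_assoc, ← pow_succ', ← hl, ← mul_assoc,
      span_singleton_mul_span_singleton, hab]
    simp⟩
  exact NoZeroDivisors.to_isDomain R

lemma IsLevel.exists_pow_le (h : IsLevel R) {I : Ideal R} (hI : I ≠ ⊥) :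
    ∃ n, maximalIdeal R ^ n ≤ I := by
  obtain ⟨x, hx, h0⟩ := Submodule.exists_mem_ne_zero_of_ne_bot hI
  obtain ⟨k, -, hk⟩ := h x h0
  exact ⟨k + 1, hk ▸ mul_le_left.trans ((span_singleton_le_iff_mem _).mpr hx)⟩

lemma IsLevel.eq_bot_or_eq_maximalIdeal (h : IsLevel R) {p : Ideal R} (hp : p.IsPrime) :
    p = ⊥ ∨ p = maximalIdeal R := by
  by_cases h0 : p = ⊥
  · exact .inl h0
  · obtain ⟨n, hn⟩ := h.exists_pow_le h0
    exact .inr (le_antisymm (le_maximalIdeal hp.ne_top) (hp.le_of_pow_le hn))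

lemma map_maximalIdeal_eq_of_surjective {A B : Type*} [CommRing A] [CommRing B] [IsLocalRing A]
    [IsLocalRing B] {f : A →+* B} (hf : Function.Surjective f) :
    (maximalIdeal A).map f = maximalIdeal B := by
  have : ((maximalIdeal B).comap f).IsMaximal := comap_isMaximal_of_surjective f hf
  rw [← eq_maximalIdeal this, map_comap_of_surjective f hf]

lemma IsLevel.of_surjective {A B : Type*} [CommRing A] [CommRing B] [IsLocalRing A]
    [IsLocalRing B] (h : IsLevel A) {f : A →+* B} (hf : Function.Surjective f) : IsLevel B := by
  intro y hy
  obtain ⟨x, rfl⟩ := hf y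
  obtain ⟨k, hx, hk⟩ := h x (by rintro rfl; simp at hy)
  refine ⟨k, ?_, ?_⟩
  · rw [← map_maximalIdeal_eq_of_surjective hf, ← Ideal.map_pow]
    exact mem_map_of_mem f hx
  · rw [← map_maximalIdeal_eq_of_surjective hf, ← Ideal.map_pow, ← hk, Ideal.map_mul, map_span,
      Set.image_singleton]

/-- Let k + 2 be the least exponent with I not inside m^(k+2). An element of I witnessing this gives
m^(k+2) ⊆ I. For a in m outside m^2, I ⊆ m^(k+1) = a^k m, hence I = a^k J where J consists of the r
in m with a^k r ∈ I; both J and aR contain m^2. If I lies in all powers of m, then I = 0 = m^n. -/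
lemma IsLevel.exists_prod_eq (h : IsLevel R) {I : Ideal R} (hI : I ≠ ⊤) {n : ℕ}
    (hn : maximalIdeal R ^ n ≤ I) : ∃ s : Multiset (Ideal R),
      (∀ J ∈ s, maximalIdeal R ^ 2 ≤ J ∧ J ≤ maximalIdeal R) ∧ s.prod = I := by
  classical
  have hIm := le_maximalIdeal hI
  by_cases hex : ∃ j, ¬ I ≤ maximalIdeal R ^ j
  swap
  · push Not at hex
    have hbot : I = ⊥ := eq_bot_iff.mpr fun x hx =>
      (Submodule.mem_bot R).mpr (h.eq_zero_of_forall_mem_pow fun j => hex j hx)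
    refine ⟨Multiset.replicate n (maximalIdeal R), fun J hJ => ?_, ?_⟩
    · rw [Multiset.eq_of_mem_replicate hJ]
      exact ⟨pow_le_self two_ne_zero, le_rfl⟩
    · rw [Multiset.prod_replicate]
      exact le_antisymm hn (hbot ▸ bot_le)
  obtain ⟨k, hk⟩ : ∃ k, Nat.find hex = k + 2 := by
    refine ⟨Nat.find hex - 2, ?_⟩
    have h0 : Nat.find hex ≠ 0 := fun h0 => by
      have := Nat.find_spec hex; rw [h0] at this; simp at this
    have h1 : Nat.find hex ≠ 1 := fun h0 => by
      have := Nat.find_spec hex; rw [h0] at this; simp [hIm] at this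
    lia
  have hIk : I ≤ maximalIdeal R ^ (k + 1) := by
    by_contra h
    have := Nat.find_min' hex h
    lia
  obtain ⟨x, hxI, hx⟩ := SetLike.not_le_iff_exists.mp (hk ▸ Nat.find_spec hex)
  have hxm := h.span_mul_eq (hIk hxI) hx
  have hkI : maximalIdeal R ^ (k + 2) ≤ I :=
    hxm ▸ mul_le_left.trans ((span_singleton_le_iff_mem _).mpr hxI)
  obtain ⟨a, ha, ha2⟩ : ∃ y ∈ maximalIdeal R, y ∉ maximalIdeal R ^ 2 := by
    by_contra! h
    have heq : maximalIdeal R = maximalIdeal R ^ 2 := le_antisymm h (pow_le_self two_ne_zero)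
    rw [show k + 1 + 1 = (k + 1) + 1 from rfl, pow_succ_eq_of_eq_sq heq] at hx
    exact hx (hIm hxI)
  have ham : span {a} * maximalIdeal R = maximalIdeal R ^ 2 :=
    h.span_mul_eq (k := 1) (by simpa using ha) ha2
  have hak := span_pow_mul_maximalIdeal ham k
  let J : Ideal R := maximalIdeal R ⊓ Submodule.comap (LinearMap.mulLeft R (a ^ k)) I
  have hJ : ∀ r, r ∈ J ↔ r ∈ maximalIdeal R ∧ a ^ k * r ∈ I := fun r => by simp [J]
  refine ⟨J ::ₘ Multiset.replicate k (span {a}), fun K hK => ?_, ?_⟩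
  · rcases Multiset.mem_cons.mp hK with rfl | hK
    · refine ⟨fun r hr => (hJ r).mpr ⟨pow_le_self two_ne_zero hr, hkI ?_⟩, inf_le_left⟩
      rw [pow_add]
      exact mul_mem_mul (pow_mem_pow ha k) hr
    · rw [Multiset.eq_of_mem_replicate hK]
      exact ⟨ham ▸ mul_le_left, (span_singleton_le_iff_mem _).mpr ha⟩
  · rw [Multiset.prod_cons, Multiset.prod_replicate, span_singleton_pow, mul_comm]
    refine le_antisymm ?_ fun y hy => ?_
    · rw [span_singleton_mul_le_iff]
      exact fun z hz => ((hJ z).mp hz).2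
    · have := hIk hy
      rw [← hak] at this
      obtain ⟨z, hz, rfl⟩ := mem_span_singleton_mul.mp this
      exact mul_mem_mul (mem_span_singleton_self _) ((hJ z).mpr ⟨hz, hy⟩)

lemma IsLevel.isTAFRing (h : IsLevel R) : IsTAFRing R := by
  intro I hI
  by_cases hn : ∃ n, maximalIdeal R ^ n ≤ I
  · obtain ⟨n, hn⟩ := hn
    obtain ⟨s, hs, hsI⟩ := h.exists_prod_eq hI hn
    exact ⟨s, fun J hJ => isNAbsorbing_two_of_sq_le (hs J hJ).1 (hs J hJ).2, hsI⟩
  · have hbot : I = ⊥ := by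
      by_contra h0
      exact hn (h.exists_pow_le h0)
    rcases h.isDomain_or with hD | ⟨n, h0⟩
    · exact ⟨{I}, by simpa [hbot] using isNAbsorbing_two_of_isPrime isPrime_bot, by simp⟩
    · exact absurd ⟨n, h0 ▸ bot_le⟩ hn

/-! ### Pseudo-valuation rings that are atomic or finite-absorbing are level. -/

lemma IsPVR.isLocalRing {A : Type*} [CommRing A] (h : IsPVR A) : IsLocalRing A := by
  obtain ⟨M, hM, -, h⟩ := h
  refine IsLocalRing.of_unique_max_ideal ⟨M, hM, fun N hN => ?_⟩
  refine hN.eq_of_le hM.ne_top fun b hb => ?_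
  rcases h 1 b with h | h
  · simp only [span_singleton_one, top_mul] at h
    have : M = span {b} := hM.eq_of_le
      (fun ht => hN.ne_top (eq_top_iff.mpr (ht ▸ (span_singleton_le_iff_mem _).mpr hb))) h
    rw [this]; exact mem_span_singleton_self b
  · simpa [span_singleton_le_iff_mem] using h

lemma IsPVR.isStronglyPrime (h : IsPVR R) : IsStronglyPrime (maximalIdeal R) := by
  obtain ⟨M, hM, h⟩ := h
  rwa [← eq_maximalIdeal hM]

lemma IsStronglyPrime.comparable (h : IsStronglyPrime (maximalIdeal R)) (a b : R) :
    b ∈ span {a} * maximalIdeal R ∨ ∀ x ∈ maximalIdeal R, ∃ r, a * x = b * r := by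
  rcases h.2 a b with h | h
  · right
    intro x hx
    obtain ⟨r, hr⟩ := mem_span_singleton'.mp (h (mul_mem_mul (mem_span_singleton_self a) hx))
    exact ⟨r, by rw [← hr, mul_comm]⟩
  · left
    exact (span_singleton_le_iff_mem _).mp h

/-- A pseudo-valuation ring is level if its nonzero nonunits are products of elements that are not
products of two nonunits. -/
lemma IsStronglyPrime.isLevel (h : IsStronglyPrime (maximalIdeal R))
    (hat : ∀ x ∈ maximalIdeal R, x ≠ 0 → ∃ s : Multiset R, s.prod = x ∧ ∀ p ∈ s,
      p ∈ maximalIdeal R ∧ ∀ b ∈ maximalIdeal R, ∀ c ∈ maximalIdeal R, p ≠ b * c) :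
    IsLevel R := by
  -- This gives q m ⊆ p m for indecomposable p and q. In the comparable case q x = p r, a unit r
  -- would exhibit p as q times a nonunit.
  have hcmp : ∀ p q : R, (∀ b ∈ maximalIdeal R, ∀ c ∈ maximalIdeal R, p ≠ b * c) →
      p ∈ maximalIdeal R → q ∈ maximalIdeal R →
      (∀ b ∈ maximalIdeal R, ∀ c ∈ maximalIdeal R, q ≠ b * c) →
      ∀ x ∈ maximalIdeal R, q * x ∈ span {p} * maximalIdeal R := by
    intro p q hp hpm hqm hq x hx
    rcases h.comparable q p with h1 | h1
    · obtain ⟨z, hz, hzp⟩ := mem_span_singleton_mul.mp h1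
      exact absurd hzp.symm (hp q hqm z hz)
    · obtain ⟨r, hr⟩ := h1 x hx
      rw [hr]
      refine mul_mem_mul (mem_span_singleton_self p) ?_
      by_contra hru
      obtain ⟨v, rfl⟩ := notMem_maximalIdeal.mp hru
      refine hp q hqm (x * ↑v⁻¹) (mul_mem_right _ _ hx) ?_
      rw [← mul_assoc, hr, mul_assoc, Units.mul_inv, mul_one]
  -- Every nonzero y ∈ m has an indecomposable factor q, so x y lies in q m ⊆ p m.
  have hsq : ∀ p ∈ maximalIdeal R, (∀ b ∈ maximalIdeal R, ∀ c ∈ maximalIdeal R, p ≠ b * c) →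
      span {p} * maximalIdeal R = maximalIdeal R ^ 2 := by
    intro p hpm hp
    refine le_antisymm ?_ ?_
    · rw [pow_two]; exact Ideal.mul_mono_left ((span_singleton_le_iff_mem _).mpr hpm)
    · rw [pow_two, Ideal.mul_le]
      intro x hx y hy
      by_cases hy0 : y = 0
      · simp [hy0]
      obtain ⟨s, rfl, hs⟩ := hat y hy hy0
      obtain ⟨q, hq⟩ := Multiset.exists_mem_of_ne_zero (s := s) (by
        rintro rfl; simp at hy)
      obtain ⟨t, rfl⟩ := Multiset.exists_cons_of_mem hq
      rw [Multiset.prod_cons, mul_left_comm]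
      exact hcmp p q hp hpm (hs q hq).1 (hs q hq).2 _ (mul_mem_right _ _ hx)
  have key : ∀ s : Multiset R, (∀ p ∈ s, p ∈ maximalIdeal R ∧
      ∀ b ∈ maximalIdeal R, ∀ c ∈ maximalIdeal R, p ≠ b * c) →
      span {s.prod} * maximalIdeal R = maximalIdeal R ^ (s.card + 1) := by
    intro s
    induction s using Multiset.induction_on with
    | empty => simp
    | cons p s ih =>
      intro hs
      have hp := hs p (Multiset.mem_cons_self p s)
      rw [Multiset.prod_cons, ← span_singleton_mul_span_singleton, mul_assoc,
        ih fun q hq => hs q (Multiset.mem_cons_of_mem hq), pow_succ', ← mul_assoc,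
        hsq p hp.1 hp.2, ← pow_add, Multiset.card_cons]
      congr 1; lia
  intro x hx
  by_cases hxm : x ∈ maximalIdeal R
  · obtain ⟨s, rfl, hs⟩ := hat x hxm hx
    exact ⟨s.card, multiset_prod_mem_pow s fun p hp => (hs p hp).1, key s hs⟩
  · refine ⟨0, by simp, ?_⟩
    rw [span_singleton_eq_top.mpr (notMem_maximalIdeal.mp hxm), top_mul, zero_add, pow_one]

/-- The weak notion of irreducibility suffices: if p = b c with c ∈ m and pR = bR, then b ∈ b m, so
b = 0. Thus a nonzero irreducible is not a product of two nonunits. -/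
lemma IsPVR.isLevel_of_isAtomicRing (h : IsPVR R) (ha : IsAtomicRing R) : IsLevel R := by
  refine h.isStronglyPrime.isLevel fun x hx hx0 => ?_
  obtain ⟨s, hs, hsx⟩ := ha x hx0 ((mem_maximalIdeal x).mp hx)
  refine ⟨s, hsx, fun p hp => ⟨(mem_maximalIdeal p).mpr (hs p hp).1, fun b hb c hc hpbc => ?_⟩⟩
  have hp0 : p ≠ 0 := by
    rintro rfl
    exact hx0 (hsx ▸ Multiset.prod_eq_zero hp)
  have aux : ∀ b c : R, c ∈ maximalIdeal R → p = b * c → span {p} = span {b} → p = 0 := by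
    intro b c hc hpbc heq
    have hb : b ∈ span {p} := heq ▸ mem_span_singleton_self b
    have : b ∈ span {b} * maximalIdeal R := by
      obtain ⟨r, hr⟩ := mem_span_singleton'.mp hb
      rw [hpbc] at hr
      refine mem_span_singleton_mul.mpr ⟨r * c, mul_mem_left _ r hc, ?_⟩
      rw [← hr]; linear_combination r * c * hr
    rw [hpbc, eq_zero_of_mem_span_mul this, zero_mul]
  rcases (hs p hp).2 b c hpbc with h1 | h1
  · exact hp0 (aux b c hc hpbc h1)
  · exact hp0 (aux c b hb (by rw [hpbc, mul_comm]) h1)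

/-- On nonzero elements, y ∈ z m is a strict partial order, so a finite nonempty family has an
extremal member. -/
lemma exists_forall_notMem_span_mul (s : Multiset R) (hs : s ≠ 0) (h0 : ∀ x ∈ s, x ≠ 0) :
    ∃ y ∈ s, ∀ z ∈ s, y ∉ span {z} * maximalIdeal R := by
  induction s using Multiset.induction_on with
  | empty => exact absurd rfl hs
  | cons a s ih =>
    have ha : a ∉ span {a} * maximalIdeal R := fun h =>
      h0 a (Multiset.mem_cons_self a s) (eq_zero_of_mem_span_mul h)
    by_cases hs0 : s = 0
    · subst hs0
      exact ⟨a, by simp, by simpa using ha⟩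
    obtain ⟨y, hy, hyz⟩ := ih hs0 fun x hx => h0 x (Multiset.mem_cons_of_mem hx)
    by_cases hya : y ∈ span {a} * maximalIdeal R
    · refine ⟨a, Multiset.mem_cons_self a s, fun z hz => ?_⟩
      rcases Multiset.mem_cons.mp hz with rfl | hz
      · exact ha
      · intro haz
        refine hyz z hz ?_
        obtain ⟨w, hw, rfl⟩ := mem_span_singleton_mul.mp hya
        exact mul_mem_right _ _ haz
    · refine ⟨y, Multiset.mem_cons_of_mem hy, fun z hz => ?_⟩
      rcases Multiset.mem_cons.mp hz with rfl | hz
      exacts [hya, hyz z hz]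

lemma pow_dvd_prod_of_mul {R : Type*} [CommRing R] {y : R} (n : ℕ) (s : Multiset R) (hs : 2 * n ≤ s.card)
    (h : ∀ a ∈ s, ∀ b ∈ s, y ∣ a * b) : y ^ n ∣ s.prod := by
  induction n generalizing s with
  | zero => simp
  | succ n ih =>
    obtain ⟨a, s, rfl⟩ := Multiset.exists_mem_of_ne_zero (s := s) (by rintro rfl; simp at hs)
      |>.imp fun x hx => Multiset.exists_cons_of_mem hx
    obtain ⟨b, s, rfl⟩ := Multiset.exists_mem_of_ne_zero (s := s) (by rintro rfl; simp at hs; lia)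
      |>.imp fun x hx => Multiset.exists_cons_of_mem hx
    rw [Multiset.prod_cons, Multiset.prod_cons, ← mul_assoc, pow_succ']
    refine mul_dvd_mul (h a (by simp) b (by simp)) (ih s (by simp at hs; lia) fun c hc d hd => ?_)
    exact h c (by simp [hc]) d (by simp [hd])

/-- In a finite-absorbing pseudo-valuation ring the lengths of the factorizations of a nonzero
element are bounded. -/
lemma IsStronglyPrime.exists_bound (h : IsStronglyPrime (maximalIdeal R))
    (hF : IsFiniteAbsorbing R) {x : R} (hx : x ≠ 0) : ∃ N : ℕ, ∀ s : Multiset R,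
      (∀ p ∈ s, p ∈ maximalIdeal R) → s.prod = x → s.card < N := by
  -- If x m ≠ 0, the test ideal is x m and the product y x is used, y being an extremal factor of x.
  -- If x m = 0, the test ideal is 0.
  by_cases hxm : ∃ r ∈ maximalIdeal R, x * r ≠ 0
  · obtain ⟨r, hr, hxr⟩ := hxm
    have hle : span {x} * maximalIdeal R ≤ maximalIdeal R := mul_le_right
    obtain ⟨n, hn, hI⟩ := hF (span {x} * maximalIdeal R)
      fun ht => (maximalIdeal.isMaximal R).ne_top (top_le_iff.mp (ht ▸ hle))
    refine ⟨n + 1, fun s hs hsx => ?_⟩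
    by_contra! hcard
    obtain ⟨y, hy, hyz⟩ := exists_forall_notMem_span_mul s (by rintro rfl; simp at hcard)
      (by rintro z hz rfl; exact hx (hsx ▸ Multiset.prod_eq_zero hz))
    obtain ⟨a, t, hat, ht⟩ := (hI.mono (by lia : n ≤ s.card)).exists_cons (y ::ₘ s) (by simp)
      (by rw [Multiset.prod_cons, hsx, mul_comm y x]
          exact mul_mem_mul (mem_span_singleton_self x) (hs y hy))
    rcases Multiset.cons_eq_cons.mp hat with ⟨rfl, rfl⟩ | ⟨-, w, rfl, rfl⟩
    · exact hx (eq_zero_of_mem_span_mul (hsx ▸ ht))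
    -- A factor a of x was dropped, so (y - a m) w.prod = 0. Comparing a with y - a m either puts y
    -- in aR times the maximal ideal, against extremality, or makes a r a multiple of y - a m and
    -- hence x r = 0.
    · obtain ⟨m, hm, hmx⟩ := mem_span_singleton_mul.mp ht
      rw [Multiset.prod_cons] at hmx hsx
      have hya := hyz a (Multiset.mem_cons_self a w)
      rcases h.comparable a (y - a * m) with h1 | h1
      · refine hya ?_
        have : y = (y - a * m) + a * m := by ring
        rw [this]
        exact add_mem h1 (mul_mem_mul (mem_span_singleton_self a) hm)
      · obtain ⟨e, he⟩ := h1 r hr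
        apply hxr
        linear_combination (-r) * hsx + w.prod * he - e * hmx - e * m * hsx
  · push Not at hxm
    obtain ⟨n, hn, hI⟩ := hF ⊥ bot_ne_top
    -- Compare y^n with x. If x = y^n z, then z y^(n+1) = x y = 0 and dropping one factor leaves
    -- y^(n+1) = 0 or x = 0; otherwise y^(n+1) ∈ xR and y^(n+2) = 0. The absorbing property then
    -- lowers the exponent to n.
    have hnil : ∀ y ∈ maximalIdeal R, y ^ n = 0 := by
      intro y hy
      have hex : ∃ k, y ^ k = 0 := by
        rcases h.comparable (y ^ n) x with h1 | h1
        · obtain ⟨z, hz, hzx⟩ := mem_span_singleton_mul.mp h1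
          obtain ⟨a, t, hat, ht⟩ := (hI.mono n.le_succ).exists_cons
            (z ::ₘ Multiset.replicate (n + 1) y) (by simp) (by
              rw [Multiset.prod_cons, Multiset.prod_replicate, Submodule.mem_bot,
                ← hxm y hy, ← hzx]; ring)
          rcases Multiset.cons_eq_cons.mp hat with ⟨rfl, rfl⟩ | ⟨-, w, hw, rfl⟩
          · exact ⟨n + 1, by simpa [pow_succ'] using ht⟩
          · have hwe : w = Multiset.replicate n y := by
              rw [Multiset.eq_replicate]
              constructor
              · have := congrArg Multiset.card hw; simpa using this.symm
              · intro b hb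
                exact Multiset.eq_of_mem_replicate (n := n + 1)
                  (hw ▸ Multiset.mem_cons_of_mem hb)
            rw [hwe, Multiset.prod_cons, Multiset.prod_replicate, Submodule.mem_bot, mul_comm,
              hzx] at ht
            exact absurd ht hx
        · obtain ⟨r, hr⟩ := h1 y hy
          refine ⟨n + 2, ?_⟩
          have := hxm y hy
          rw [pow_add, pow_two, ← mul_assoc, hr]
          linear_combination r * this
      obtain ⟨k, hk⟩ := hex
      obtain ⟨t, ht, htc, htp⟩ := hI.exists_le (Multiset.replicate k y) (by simpa using hk)
      obtain ⟨j, hj, rfl⟩ := Multiset.le_replicate_iff.mp ht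
      rw [Multiset.prod_replicate] at htp
      exact pow_eq_zero_of_le (by simpa using htc) htp
    refine ⟨2 * n, fun s hs hsx => ?_⟩
    by_contra! hcard
    obtain ⟨y, hy, hyz⟩ := exists_forall_notMem_span_mul s (by rintro rfl; simp at hcard; lia)
      (by rintro z hz rfl; exact hx (hsx ▸ Multiset.prod_eq_zero hz))
    -- By extremality y divides the product of any two factors, so 2n factors contain y^n = 0.
    have := pow_dvd_prod_of_mul (y := y) n s hcard fun a ha b hb => by
      rcases h.comparable a y with h1 | h1
      · exact absurd h1 (hyz a ha)
      · obtain ⟨r, hr⟩ := h1 b (hs b hb)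
        exact ⟨r, hr⟩
    rw [hnil y (hs y hy), zero_dvd_iff, hsx] at this
    exact hx this

/-- In a factorization of maximal length no factor is a product of two nonunits, since splitting it
would lengthen the factorization. -/
lemma IsPVR.isLevel_of_isFiniteAbsorbing (h : IsPVR R) (hF : IsFiniteAbsorbing R) :
    IsLevel R := by
  classical
  refine h.isStronglyPrime.isLevel fun x hx hx0 => ?_
  obtain ⟨N, hN⟩ := h.isStronglyPrime.exists_bound hF hx0
  let S : ℕ → Prop := fun k => ∃ s : Multiset R, (∀ p ∈ s, p ∈ maximalIdeal R) ∧ s.prod = x ∧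
    s.card = k
  have hS1 : S 1 := ⟨{x}, by simpa using hx, by simp, by simp⟩
  have hb : ∀ k, S k → k ≤ N := fun k ⟨s, hs, hsx, hk⟩ => hk ▸ (hN s hs hsx).le
  obtain ⟨s, hs, hsx, hk⟩ := Nat.findGreatest_spec (P := S) (hb 1 hS1) hS1
  refine ⟨s, hsx, fun p hp => ⟨hs p hp, fun b hb' c hc hpbc => ?_⟩⟩
  obtain ⟨t, rfl⟩ := Multiset.exists_cons_of_mem hp
  have hS : S ((b ::ₘ c ::ₘ t).card) := by
    refine ⟨_, fun q hq => ?_, ?_, rfl⟩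
    · rcases Multiset.mem_cons.mp hq with rfl | hq
      · exact hb'
      rcases Multiset.mem_cons.mp hq with rfl | hq
      · exact hc
      · exact hs q (Multiset.mem_cons_of_mem hq)
    · rw [← hsx, hpbc]; simp [mul_assoc]
  have := Nat.le_findGreatest (hb _ hS) hS
  simp only [Multiset.card_cons] at this hk
  lia

end Local

/-! ### TAF-rings: quotients, localizations, minimal primes. -/

section FactorizationLocal

open IsLocalRing Ideal

variable {R : Type*} [CommRing R]

/-- Every localization at a maximal ideal is level. -/
def IsLocallyLevel (R : Type*) [CommRing R] : Prop :=
  ∀ (M : Ideal R) [M.IsMaximal], IsLevel (Localization.AtPrime M)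

/-- The cases are no proper factor, at least two, or exactly one. -/
lemma multiset_prod_ideal_cases {M : Ideal R} (s : Multiset (Ideal R))
    (h : ∀ J ∈ s, J = ⊤ ∨ J ≤ M) :
    s.prod = ⊤ ∨ s.prod ≤ M ^ 2 ∨ ∃ J ∈ s, s.prod = J ∧ J ≤ M := by
  induction s using Multiset.induction_on with
  | empty => left; simp
  | cons J s ih =>
    have ih := ih fun K hK => h K (Multiset.mem_cons_of_mem hK)
    rw [Multiset.prod_cons]
    rcases h J (Multiset.mem_cons_self J s) with rfl | hJ
    · rw [top_mul]
      refine ih.imp id (Or.imp id ?_)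
      rintro ⟨K, hK, h1, h2⟩
      exact ⟨K, Multiset.mem_cons_of_mem hK, h1, h2⟩
    · rcases ih with h1 | h1 | ⟨K, -, h1, h2⟩
      · right; right
        exact ⟨J, Multiset.mem_cons_self J s, by rw [h1, mul_top], hJ⟩
      · right; left
        rw [pow_two]
        exact Ideal.mul_mono hJ (h1.trans (pow_le_self two_ne_zero))
      · right; left
        rw [pow_two, h1]
        exact Ideal.mul_mono hJ h2

lemma multiset_prod_ideal_le {s : Multiset (Ideal R)} {J : Ideal R} (hJ : J ∈ s) : s.prod ≤ J :=
  Ideal.le_of_dvd (Multiset.dvd_prod hJ)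

lemma IsTAFRing.of_surjective {A B : Type*} [CommRing A] [CommRing B] {f : A →+* B}
    (hf : Function.Surjective f) (h : IsTAFRing A) : IsTAFRing B := by
  intro I hI
  obtain ⟨s, hs, hsI⟩ := h (I.comap f) (comap_ne_top f hI)
  refine ⟨s.map (Ideal.map f), fun K hK => ?_, ?_⟩
  · obtain ⟨J, hJ, rfl⟩ := Multiset.mem_map.mp hK
    -- Each factor contains the product, hence the kernel, so membership in J can be tested after
    -- applying f.
    have hker : RingHom.ker f ≤ J :=
      (ker_le_comap f).trans (hsI ▸ multiset_prod_ideal_le hJ)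
    have hmem : ∀ x, f x ∈ J.map f ↔ x ∈ J := fun x => by
      rw [← mem_comap, comap_map_of_surjective' f hf, sup_eq_left.mpr hker]
    have h2 := isNAbsorbing_two_iff.mp (hs J hJ)
    rw [isNAbsorbing_two_iff]
    intro a b c habc
    obtain ⟨a, rfl⟩ := hf a
    obtain ⟨b, rfl⟩ := hf b
    obtain ⟨c, rfl⟩ := hf c
    simp only [← map_mul, hmem] at habc ⊢
    exact h2 a b c habc
  · have : (s.map (Ideal.map f)).prod = s.prod.map f := by
      rw [← Ideal.mapHom_apply, map_multiset_prod]; rfl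
    rw [this, hsI, map_comap_of_surjective f hf]

lemma IsTAFRing.atPrime (h : IsTAFRing R) (P : Ideal R) [hP : P.IsPrime] :
    IsTAFRing (Localization.AtPrime P) := by
  intro I hI
  set f := algebraMap R (Localization.AtPrime P)
  obtain ⟨s, hs, hsI⟩ := h (I.comap f) (comap_ne_top f hI)
  refine ⟨s.map (Ideal.map f), fun K hK => ?_, ?_⟩
  · obtain ⟨J, hJ, rfl⟩ := Multiset.mem_map.mp hK
    exact (hs J hJ).map_atPrime
  · have : (s.map (Ideal.map f)).prod = s.prod.map f := by
      rw [← Ideal.mapHom_apply, map_multiset_prod]; rfl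
    rw [this, hsI]
    exact IsLocalization.map_under P.primeCompl _ I

lemma IsTAFRing.finite_minimalPrimes (h : IsTAFRing R) (I : Ideal R) :
    I.minimalPrimes.Finite := by
  by_cases hI : I = ⊤
  · simp [hI, Ideal.minimalPrimes_top]
  obtain ⟨s, hs, rfl⟩ := h I hI
  clear hI
  refine Set.Finite.subset (s := ⋃ J ∈ {J | J ∈ s}, J.minimalPrimes)
    (Set.Finite.biUnion (Multiset.finite_toSet s) fun J hJ => (hs J hJ).finite_minimalPrimes) ?_
  intro p hp
  obtain ⟨J, hJ, hJp⟩ : ∃ J ∈ s, J ≤ p := by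
    have := hp.1.1
    exact (IsPrime.multiset_prod_le this).mp hp.1.2
  simp only [Set.mem_ofPred_eq, Set.mem_iUnion]
  exact ⟨J, hJ, ⟨hp.1.1, hJp⟩, fun q hq hqp =>
    hp.2 ⟨hq.1, (multiset_prod_ideal_le hJ).trans hq.2⟩ hqp⟩

/-! ### Local TAF-rings are level. -/

section

variable [IsLocalRing R]

lemma IsTAFRing.isNAbsorbing_two_of_not_le (h : IsTAFRing R) {I : Ideal R}
    (hI : I ≤ maximalIdeal R) (hI2 : ¬ I ≤ maximalIdeal R ^ 2) : IsNAbsorbing 2 I := by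
  have htop : I ≠ ⊤ := fun ht =>
    (maximalIdeal.isMaximal R).ne_top (top_le_iff.mp (ht ▸ hI))
  obtain ⟨s, hs, rfl⟩ := h I htop
  rcases multiset_prod_ideal_cases (M := maximalIdeal R) s fun J hJ => by
      by_cases h : J = ⊤
      exacts [.inl h, .inr (le_maximalIdeal h)] with h1 | h1 | ⟨J, hJ, h1, -⟩
  · exact absurd h1 htop
  · exact absurd h1 hI2
  · rw [h1]; exact hs J hJ

/-- For t ∈ m the ideal (z, t^3) is not inside m^2, hence is 2-absorbing, so t^2 ∈ (z, t^3) and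
Nakayama gives t^2 ∈ (z). Thus (z) has radical m, and being 2-absorbing itself it contains m^2. -/
lemma IsTAFRing.sq_le_span (h : IsTAFRing R) {z : R} (hz : z ∈ maximalIdeal R)
    (hz2 : z ∉ maximalIdeal R ^ 2) : maximalIdeal R ^ 2 ≤ span {z} := by
  have hzm : span {z} ≤ maximalIdeal R := (span_singleton_le_iff_mem _).mpr hz
  have habs := h.isNAbsorbing_two_of_not_le hzm fun hle =>
    hz2 ((span_singleton_le_iff_mem _).mp hle)
  have hrad : maximalIdeal R ≤ (span {z}).radical := by
    intro t ht
    have h2 : IsNAbsorbing 2 (span {z} ⊔ span {t ^ 2 * t}) :=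
      h.isNAbsorbing_two_of_not_le
        (sup_le hzm ((span_singleton_le_iff_mem _).mpr (mul_mem_left _ _ ht)))
        (fun hle => hz2 (hle (mem_sup_left (mem_span_singleton_self z))))
    have ht2 := h2.sq_mem (x := t) ⟨3, by
      rw [pow_succ t 2]; exact mem_sup_right (mem_span_singleton_self _)⟩
    exact ⟨2, mem_of_mem_sup_span_mul ht ht2⟩
  exact (Ideal.pow_right_mono hrad 2).trans habs.radical_sq_le

/-- A local TAF-ring whose maximal ideal is not idempotent is level. -/
lemma IsTAFRing.isLevel_of_ne_sq (h : IsTAFRing R)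
    (hm : maximalIdeal R ≠ maximalIdeal R ^ 2) : IsLevel R := by
  have ha : ∀ y ∈ maximalIdeal R, y ∉ maximalIdeal R ^ 2 → maximalIdeal R ^ 2 ≤ span {y} :=
    fun y hy hy2 => h.sq_le_span hy hy2
  refine .of_sq_le ha fun x hx => ?_
  obtain ⟨z, hz, hz2⟩ : ∃ y ∈ maximalIdeal R, y ∉ maximalIdeal R ^ 2 := by
    by_contra! h
    exact hm (le_antisymm h (pow_le_self two_ne_zero))
  have hzm := span_mul_maximalIdeal_eq_sq hz hz2 (ha z hz hz2)
  obtain ⟨s, hs, hsx⟩ := h (span {x}) fun ht =>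
    (maximalIdeal.isMaximal R).ne_top (top_le_iff.mp
      (ht ▸ (span_singleton_le_iff_mem _).mpr (by simpa using hx 1)))
  -- If a factor J lies in all powers of m, the 2-absorbing property gives J ⊆ z J, whence x ∈ x m.
  -- If none does, each factor contains a power of m, so m^N ⊆ xR ⊆ m^(N+1) = z^N m, which forces
  -- z^N = 0 and m^(N+1) = 0.
  by_cases hJ : ∃ J ∈ s, ∀ j ∈ J, ∀ n, j ∈ maximalIdeal R ^ n
  · obtain ⟨J, hJs, hJ⟩ := hJ
    have hzJ : J ≤ span {z} * J := by
      intro j hj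
      have := hJ j hj 3
      rw [← span_pow_mul_maximalIdeal hzm 2] at this
      obtain ⟨t, ht, rfl⟩ := mem_span_singleton_mul.mp this
      rcases isNAbsorbing_two_iff.mp (hs J hJs) z z t (by rwa [← pow_two]) with h1 | h1 | h1
      · have h3 := hJ _ h1 3
        rw [← span_pow_mul_maximalIdeal hzm 2, pow_two] at h3
        rw [pow_two, eq_zero_of_mem_span_mul h3, zero_mul]
        exact zero_mem _
      all_goals
        rw [pow_two, mul_assoc]
        exact mul_mem_mul (mem_span_singleton_self z) h1
    obtain ⟨t, rfl⟩ := Multiset.exists_cons_of_mem hJs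
    have hle : span {x} ≤ span {z} * span {x} := by
      rw [← hsx, Multiset.prod_cons, ← mul_assoc]
      exact Ideal.mul_mono_left hzJ
    refine eq_zero_of_mem_span_mul ?_
    rw [mul_comm]
    exact Ideal.mul_mono_left ((span_singleton_le_iff_mem _).mpr hz)
      (hle (mem_span_singleton_self x))
  · push Not at hJ
    have hpow : ∃ N, maximalIdeal R ^ N ≤ s.prod := by
      clear hsx hs
      induction s using Multiset.induction_on with
      | empty => exact ⟨0, by simp⟩
      | cons J s ih =>
        obtain ⟨N, hN⟩ := ih fun K hK => hJ K (Multiset.mem_cons_of_mem hK)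
        obtain ⟨j, hj, hjn⟩ := hJ J (Multiset.mem_cons_self J s)
        obtain ⟨k, hk, hk1⟩ := exists_mem_pow_notMem_pow_succ hjn
        refine ⟨k + 1 + N, ?_⟩
        rw [pow_add, Multiset.prod_cons]
        refine Ideal.mul_mono ?_ hN
        rw [← span_mul_eq_of_sq_le ha hk hk1]
        exact mul_le_left.trans ((span_singleton_le_iff_mem _).mpr hj)
    obtain ⟨N, hN⟩ := hpow
    rw [hsx] at hN
    have h1 : z ^ N ∈ span {z ^ N} * maximalIdeal R := by
      rw [span_pow_mul_maximalIdeal hzm]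
      exact ((span_singleton_le_iff_mem _).mpr (hx (N + 1))) (hN (pow_mem_pow hz N))
    have h2 := hx (N + 1)
    rw [← span_pow_mul_maximalIdeal hzm, eq_zero_of_mem_span_mul h1] at h2
    simpa using h2

/-- Each 2-absorbing factor contains the square of its radical, hence m^2 = m, and a product of such
ideals again contains m. -/
lemma IsTAFRing.eq_maximalIdeal_of_radical_eq (h : IsTAFRing R)
    (hm : maximalIdeal R = maximalIdeal R ^ 2) {I : Ideal R} (hI : I.radical = maximalIdeal R) :
    I = maximalIdeal R := by
  have htop : I ≠ ⊤ := by
    rintro rfl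
    rw [radical_top] at hI
    exact (maximalIdeal.isMaximal R).ne_top hI.symm
  refine le_antisymm (le_maximalIdeal htop) ?_
  obtain ⟨s, hs, rfl⟩ := h I htop
  have hsJ : ∀ J ∈ s, maximalIdeal R ≤ J := fun J hJ => by
    rw [hm, ← hI]
    exact (Ideal.pow_right_mono (radical_mono (multiset_prod_ideal_le hJ)) 2).trans
      (hs J hJ).radical_sq_le
  clear hI htop hs
  induction s using Multiset.induction_on with
  | empty => simp
  | cons J s ih =>
    rw [hm, pow_two, Multiset.prod_cons]
    exact Ideal.mul_mono (hsJ J (Multiset.mem_cons_self J s))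
      (ih fun K hK => hsJ K (Multiset.mem_cons_of_mem hK))

/-- If m were idempotent, then P + xR = m, and squaring gives x ∈ P + x^2 R. Nakayama puts x in P,
so P = m. -/
lemma IsTAFRing.isLevel_of_radical_eq (h : IsTAFRing R) {P : Ideal R} (hP : P.IsPrime)
    (hPm : P ≠ maximalIdeal R) {x : R} (hx : (P ⊔ span {x}).radical = maximalIdeal R) :
    IsLevel R := by
  refine h.isLevel_of_ne_sq fun hm => ?_
  have hI := h.eq_maximalIdeal_of_radical_eq hm hx
  have hxm : x ∈ maximalIdeal R := hI ▸ mem_sup_right (mem_span_singleton_self x)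
  have hxP : x ∈ P := by
    refine mem_of_mem_sup_span_mul hxm ?_
    have h2 : (P ⊔ span {x}) * (P ⊔ span {x}) ≤ P ⊔ span {x * x} := by
      rw [Ideal.sup_mul, Ideal.mul_sup, Ideal.mul_sup, span_singleton_mul_span_singleton]
      have h3 : P * P ≤ P := Ideal.mul_le_left
      have h4 : P * span {x} ≤ P := Ideal.mul_le_left
      have h5 : span {x} * P ≤ P := Ideal.mul_le_right
      exact sup_le ((sup_le h3 h4).trans le_sup_left) (sup_le (h5.trans le_sup_left) le_sup_right)
    rw [hI, ← pow_two, ← hm] at h2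
    exact h2 hxm
  rw [sup_eq_left.mpr ((span_singleton_le_iff_mem _).mpr hxP), hP.radical] at hx
  exact hPm hx

lemma radical_eq_maximalIdeal_of_mem_minimalPrimes {I : Ideal R}
    (hI : maximalIdeal R ∈ I.minimalPrimes) : I.radical = maximalIdeal R := by
  rw [radical_eq_sInf]
  refine le_antisymm (sInf_le ⟨hI.1.2, hI.1.1⟩) (le_sInf fun J hJ => ?_)
  exact hI.2 ⟨hJ.2, hJ.1⟩ (le_maximalIdeal hJ.2.ne_top)

lemma exists_mem_minimalPrimes_sup_span {R : Type*} [CommRing R] {P Q : Ideal R} [hQ : Q.IsPrime] (hPQ : P < Q) :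
    ∃ x ∉ P, ∃ M ∈ (P ⊔ span {x}).minimalPrimes, M ≤ Q := by
  obtain ⟨x, hxQ, hxP⟩ := SetLike.exists_of_lt hPQ
  exact ⟨x, hxP, exists_minimalPrimes_le
    (sup_le hPQ.le ((span_singleton_le_iff_mem _).mpr hxQ))⟩

lemma IsTAFRing.isLevel (h : IsTAFRing R) : IsLevel R := by
  by_cases hm : maximalIdeal R = maximalIdeal R ^ 2
  swap
  · exact h.isLevel_of_ne_sq hm
  by_cases hP : ∃ P : Ideal R, P.IsPrime ∧ P ≠ maximalIdeal R
  swap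
  · push Not at hP
    have hrad : (⊥ : Ideal R).radical = maximalIdeal R := by
      rw [radical_eq_sInf]
      refine le_antisymm (sInf_le ⟨bot_le, inferInstance⟩) (le_sInf fun J hJ => (hP J hJ.2).ge)
    have h0 := h.eq_maximalIdeal_of_radical_eq hm hrad
    refine .of_sq_le (fun y hy => ?_) fun x hx => ?_
    · rw [← hm]; exact fun hy' => absurd hy hy'
    · have := hx 1
      rwa [pow_one, ← h0, Submodule.mem_bot] at this
  obtain ⟨P, hP, hPm⟩ := hP
  obtain ⟨x, hxP, Q, hQ, hQm⟩ := exists_mem_minimalPrimes_sup_span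
    (lt_of_le_of_ne (le_maximalIdeal hP.ne_top) hPm)
  have hQprime := hQ.1.1
  by_cases hQe : Q = maximalIdeal R
  · subst hQe
    exact h.isLevel_of_radical_eq hP hPm (radical_eq_maximalIdeal_of_mem_minimalPrimes hQ)
  exfalso
  -- Repeating the construction above Q gives a chain P < Q < N with N minimal over Q + yR. The
  -- localization at N is level, so it cannot separate the two smaller primes P and Q.
  obtain ⟨y, hyQ, N, hN, hNm⟩ := exists_mem_minimalPrimes_sup_span (lt_of_le_of_ne hQm hQe)
  have hNprime := hN.1.1
  have hPQ : P ≤ Q := le_sup_left.trans hQ.1.2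
  have hQN : Q ≤ N := le_sup_left.trans hN.1.2
  have hxQ : x ∈ Q := hQ.1.2 (mem_sup_right (mem_span_singleton_self x))
  have hyN : y ∈ N := hN.1.2 (mem_sup_right (mem_span_singleton_self y))
  set f := algebraMap R (Localization.AtPrime N)
  have hdis : ∀ K : Ideal R, K ≤ N → Disjoint (N.primeCompl : Set R) (K : Set R) := fun K hK =>
    Set.disjoint_left.mpr fun a ha haK => ha (hK haK)
  have hcomap : ∀ K : Ideal R, K.IsPrime → K ≤ N → (K.map f).comap f = K := fun K hK hKN =>
    IsLocalization.under_map_of_isPrime_disjoint N.primeCompl _ hK (hdis K hKN)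
  have hprime : ∀ K : Ideal R, K.IsPrime → K ≤ N → (K.map f).IsPrime := fun K hK hKN =>
    IsLocalization.isPrime_of_isPrime_disjoint N.primeCompl _ K hK (hdis K hKN)
  have hN' : N.map f = maximalIdeal _ := IsLocalization.AtPrime.map_eq_maximalIdeal N _
  have hlev : IsLevel (Localization.AtPrime N) := by
    refine (h.atPrime N).isLevel_of_radical_eq (hprime Q hQprime hQN) (x := f y) ?_ ?_
    · intro heq
      rw [← hN'] at heq
      refine hyQ ?_
      rw [← hcomap Q hQprime hQN, heq, hcomap N hNprime le_rfl]
      exact hyN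
    · have := IsLocalization.AtPrime.radical_map_of_mem_minimalPrimes
        (Localization.AtPrime N) N _ hN
      rwa [Ideal.map_sup, map_span, Set.image_singleton, hN'] at this
  have hbot : ∀ K : Ideal R, K.IsPrime → K ≤ N → y ∉ K → K.map f = ⊥ := by
    intro K hK hKN hyK
    refine (hlev.eq_bot_or_eq_maximalIdeal (hprime K hK hKN)).resolve_right fun heq => hyK ?_
    rw [← hcomap K hK hKN, heq, ← hN', hcomap N hNprime le_rfl]
    exact hyN
  refine hxP ?_
  rw [← hcomap P hP (hPQ.trans hQN), hbot P hP (hPQ.trans hQN) fun h => hyQ (hPQ h),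
    ← hbot Q hQprime hQN hyQ, hcomap Q hQprime hQN]
  exact hxQ

end

lemma IsTAFRing.isLocallyLevel (h : IsTAFRing R) : IsLocallyLevel R :=
  fun M _ => (h.atPrime M).isLevel

/-- In a TAF-ring, ideals whose radical is a maximal ideal `M` are comparable to `M ^ 2`. -/
lemma IsTAFRing.le_sq_or_sq_le (h : IsTAFRing R) {M Q : Ideal R} (hM : M.IsMaximal)
    (hQ : Q.radical = M) : Q ≤ M ^ 2 ∨ M ^ 2 ≤ Q := by
  have htop : Q ≠ ⊤ := by
    rintro rfl
    rw [radical_top] at hQ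
    exact hM.ne_top hQ.symm
  obtain ⟨s, hs, rfl⟩ := h Q htop
  rcases multiset_prod_ideal_cases (M := M) s fun J hJ => by
      by_cases hJt : J = ⊤
      · exact .inl hJt
      · right
        obtain ⟨N, hN, hJN⟩ := exists_le_maximal J hJt
        have : M ≤ N := hQ ▸ (radical_mono ((multiset_prod_ideal_le hJ).trans hJN)).trans
          hN.isPrime.radical.le
        rwa [hM.eq_of_le hN.ne_top this] with h1 | h1 | ⟨J, hJ, h1, -⟩
  · exact absurd h1 htop
  · exact .inl h1
  · right
    rw [← hQ, h1]
    exact (hs J hJ).radical_sq_le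

end FactorizationLocal

/-! ### Isolated components in rings with level localizations. -/

section LocallyLevel

open IsLocalRing Ideal

variable {R : Type*} [CommRing R]

/-- The contraction of an ideal `I` from the localization at one of its minimal primes,
that is, the isolated component of `I` belonging to that prime. -/
noncomputable def isolatedComponent (I : Ideal R) (P : I.minimalPrimes) : Ideal R :=
  haveI := P.2.1.1
  (I.map (algebraMap R (Localization.AtPrime P.1))).comap (algebraMap R (Localization.AtPrime P.1))

lemma mem_isolatedComponent {I : Ideal R} {P : I.minimalPrimes} {x : R} :
    x ∈ isolatedComponent I P ↔ ∃ u ∉ P.1, u * x ∈ I := by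
  have := P.2.1.1
  rw [isolatedComponent, mem_comap,
    IsLocalization.algebraMap_mem_map_algebraMap_iff P.1.primeCompl]
  rfl

lemma isolatedComponent_le (I : Ideal R) (P : I.minimalPrimes) : isolatedComponent I P ≤ P.1 := by
  intro x hx
  obtain ⟨u, hu, hux⟩ := mem_isolatedComponent.mp hx
  exact (P.2.1.1.mem_or_mem (P.2.1.2 hux)).resolve_left hu

/-- Outside M, u is invertible modulo M^n, so it can be cancelled modulo K. -/
lemma mem_of_mul_mem_of_pow_le {M K : Ideal R} [hM : M.IsMaximal] {n : ℕ} (hK : M ^ n ≤ K) {u x : R}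
    (hu : u ∉ M) (hux : u * x ∈ K) : x ∈ K := by
  have h1 : span {u} ⊔ M = ⊤ := by
    rw [sup_comm]
    exact hM.1.2 _ (left_lt_sup.mpr fun h => hu ((span_singleton_le_iff_mem _).mp h))
  have h2 : span {u} ⊔ M ^ n = ⊤ := sup_pow_eq_top h1
  obtain ⟨a, ha, b, hb, hab⟩ := Submodule.mem_sup.mp (h2 ▸ Submodule.mem_top : (1 : R) ∈ _)
  obtain ⟨r, rfl⟩ := mem_span_singleton'.mp ha
  have : x = r * (u * x) + b * x := by linear_combination (-x) * hab
  rw [this]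
  exact K.add_mem (K.mul_mem_left _ hux) (K.mul_mem_right _ (hK hb))

/-- A level localization has no primes other than zero and the maximal ideal, so a prime strictly
below M becomes zero at M. -/
lemma IsLocallyLevel.exists_mul_eq_zero (h : IsLocallyLevel R) {P M : Ideal R} (hP : P.IsPrime)
    [hM : M.IsMaximal] (hPM : P ≤ M) (hne : P ≠ M) {x : R} (hx : x ∈ P) :
    ∃ u ∉ M, u * x = 0 := by
  set f := algebraMap R (Localization.AtPrime M)
  have hdis : ∀ K : Ideal R, K ≤ M → Disjoint (M.primeCompl : Set R) (K : Set R) := fun K hK =>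
    Set.disjoint_left.mpr fun a ha haK => ha (hK haK)
  have hcomap : ∀ K : Ideal R, K.IsPrime → K ≤ M → (K.map f).comap f = K := fun K hK hKN =>
    IsLocalization.under_map_of_isPrime_disjoint M.primeCompl _ hK (hdis K hKN)
  have hprime : (P.map f).IsPrime :=
    IsLocalization.isPrime_of_isPrime_disjoint M.primeCompl _ P hP (hdis P hPM)
  have hM' : M.map f = maximalIdeal _ := IsLocalization.AtPrime.map_eq_maximalIdeal M _
  rcases (h M).eq_bot_or_eq_maximalIdeal hprime with h0 | h0
  · have hfx : f x = 0 := by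
      have := mem_map_of_mem f hx
      rwa [h0, Submodule.mem_bot] at this
    obtain ⟨u, hu⟩ := (IsLocalization.map_eq_zero_iff M.primeCompl _ x).mp hfx
    exact ⟨u, u.2, hu⟩
  · refine absurd ?_ hne
    rw [← hcomap P hP hPM, h0, ← hM', hcomap M hM.isPrime le_rfl]

lemma isolatedComponent_eq_of_not_isMaximal (h : IsLocallyLevel R) {I : Ideal R}
    (P : I.minimalPrimes) (hP : ¬ P.1.IsMaximal) : isolatedComponent I P = P.1 := by
  refine le_antisymm (isolatedComponent_le I P) fun x hx => ?_
  obtain ⟨M, hM, hPM⟩ := exists_le_maximal P.1 P.2.1.1.ne_top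
  obtain ⟨u, hu, hux⟩ := h.exists_mul_eq_zero P.2.1.1 hPM
    (fun heq => hP (heq ▸ hM)) hx
  exact mem_isolatedComponent.mpr ⟨u, fun hu' => hu (hPM hu'), hux ▸ I.zero_mem⟩

lemma IsLocallyLevel.exists_pow_le_map (h : IsLocallyLevel R) {I P : Ideal R} [P.IsMaximal]
    (hP : P ∈ I.minimalPrimes) :
    ∃ n, maximalIdeal _ ^ n ≤ I.map (algebraMap R (Localization.AtPrime P)) := by
  by_cases h0 : I.map (algebraMap R (Localization.AtPrime P)) = ⊥
  · rcases (h P).isDomain_or with hD | ⟨n, hn⟩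
    -- Here the localization is a domain and I becomes zero; minimality of P makes the maximal ideal
    -- the radical of zero, so it is zero.
    · have hr := IsLocalization.AtPrime.radical_map_of_mem_minimalPrimes
        (Localization.AtPrime P) P I hP
      rw [h0, isPrime_bot.radical, IsLocalization.AtPrime.map_eq_maximalIdeal] at hr
      exact ⟨1, by rw [pow_one, ← hr]; exact bot_le⟩
    · exact ⟨n, hn ▸ bot_le⟩
  · exact (h P).exists_pow_le h0

lemma IsLocallyLevel.exists_pow_le (h : IsLocallyLevel R) {I : Ideal R} (P : I.minimalPrimes) :
    ∃ n, P.1 ^ n ≤ isolatedComponent I P := by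
  by_cases hP : P.1.IsMaximal
  · obtain ⟨n, hn⟩ := h.exists_pow_le_map P.2
    refine ⟨n, ?_⟩
    rw [isolatedComponent, ← map_le_iff_le_comap, Ideal.map_pow,
      IsLocalization.AtPrime.map_eq_maximalIdeal]
    exact hn
  · exact ⟨1, by rw [pow_one, isolatedComponent_eq_of_not_isMaximal h P hP]⟩

lemma IsLocallyLevel.radical_isolatedComponent (h : IsLocallyLevel R) {I : Ideal R}
    (P : I.minimalPrimes) : (isolatedComponent I P).radical = P.1 := by
  refine le_antisymm ((radical_mono (isolatedComponent_le I P)).trans P.2.1.1.radical.le) ?_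
  obtain ⟨n, hn⟩ := h.exists_pow_le P
  exact fun x hx => ⟨n, hn (pow_mem_pow hx n)⟩

lemma IsLocallyLevel.isPrimary_isolatedComponent (h : IsLocallyLevel R) {I : Ideal R}
    (P : I.minimalPrimes) : (isolatedComponent I P).IsPrimary := by
  rw [isPrimary_iff, h.radical_isolatedComponent P]
  refine ⟨fun ht => P.2.1.1.ne_top (top_le_iff.mp (ht ▸ isolatedComponent_le I P)), ?_⟩
  intro x y hxy
  by_cases hy : y ∈ P.1
  · exact .inr hy
  · left
    obtain ⟨u, hu, hux⟩ := mem_isolatedComponent.mp hxy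
    refine mem_isolatedComponent.mpr ⟨u * y, fun hm => ?_, by convert hux using 1; ring⟩
    exact (P.2.1.1.mem_or_mem hm).elim hu hy

/-- If x ∉ I, choose a maximal M above (I : x) and a minimal prime P of I below M. Whether P = M or
not, some u ∉ M has u x ∈ I, a contradiction. -/
lemma IsLocallyLevel.iInf_isolatedComponent (h : IsLocallyLevel R) (I : Ideal R) :
    ⨅ P, isolatedComponent I P = I := by
  refine le_antisymm (fun x hx => ?_) (le_iInf fun P x hx =>
    mem_isolatedComponent.mpr ⟨1, P.2.1.1.one_notMem, by simpa using hx⟩)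
  by_contra hxI
  let A : Ideal R := Submodule.comap (LinearMap.mulRight R x) I
  have hA : ∀ r, r ∈ A ↔ r * x ∈ I := fun r => by simp [A]
  have hAt : A ≠ ⊤ := fun ht => hxI (by
    have := (hA 1).mp (ht ▸ Submodule.mem_top)
    simpa using this)
  obtain ⟨M, hM, hAM⟩ := exists_le_maximal A hAt
  obtain ⟨P, hP, hPM⟩ := exists_minimalPrimes_le
    (fun r hr => hAM ((hA r).mpr (I.mul_mem_right x hr)) : I ≤ M)
  have hxP := (mem_iInf.mp hx) ⟨P, hP⟩
  by_cases hPe : P = M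
  · obtain ⟨u, hu, hux⟩ := mem_isolatedComponent.mp hxP
    exact hu (hPe ▸ hAM ((hA u).mpr hux))
  · obtain ⟨u, hu, hux⟩ := h.exists_mul_eq_zero hP.1.1 hPM hPe
      (isolatedComponent_le I ⟨P, hP⟩ hxP)
    exact hu (hAM ((hA u).mpr (hux ▸ I.zero_mem)))

/-- Two minimal primes in a common maximal ideal M coincide: one different from M vanishes at M,
hence lies in the other. Comaximality passes to powers, and the components contain powers of their
primes. -/
lemma IsLocallyLevel.pairwise_isCoprime (h : IsLocallyLevel R) (I : Ideal R) :
    Pairwise (Function.onFun IsCoprime (isolatedComponent I)) := by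
  intro P Q hPQ
  have hsup : P.1 ⊔ Q.1 = ⊤ := by
    by_contra ht
    obtain ⟨M, hM, hle⟩ := exists_le_maximal _ ht
    have hPM : P.1 ≤ M := le_sup_left.trans hle
    have hQM : Q.1 ≤ M := le_sup_right.trans hle
    apply hPQ
    by_cases hPe : P.1 = M
    · have : Q.1 ≤ P.1 := hPe ▸ hQM
      exact Subtype.ext (le_antisymm (P.2.2 Q.2.1 this) this)
    · have : P.1 ≤ Q.1 := fun x hx => by
        obtain ⟨u, hu, hux⟩ := h.exists_mul_eq_zero P.2.1.1 hPM hPe hx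
        exact (Q.2.1.1.mem_or_mem (hux ▸ Q.1.zero_mem : u * x ∈ Q.1)).resolve_left
          fun hu' => hu (hQM hu')
      exact Subtype.ext (le_antisymm this (Q.2.2 P.2.1 this))
  obtain ⟨n, hn⟩ := h.exists_pow_le P
  obtain ⟨m, hm⟩ := h.exists_pow_le Q
  rw [Function.onFun, isCoprime_iff_sup_eq, eq_top_iff]
  rw [← isCoprime_iff_sup_eq] at hsup
  have := isCoprime_iff_sup_eq.mp (hsup.pow (m := n) (n := m))
  exact this ▸ sup_le_sup hn hm

theorem IsLocallyLevel.isStronglyLaskerian (h : IsLocallyLevel R)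
    (hfin : ∀ I : Ideal R, I.minimalPrimes.Finite) : IsStronglyLaskerian R := by
  classical
  refine ⟨fun I => ?_, fun Q hQ => ?_⟩
  · have := (hfin I).fintype
    refine ⟨Finset.univ.image (isolatedComponent I), ?_, ?_⟩
    · rw [Finset.inf_image, Finset.inf_univ_eq_iInf]
      exact h.iInf_isolatedComponent I
    · intro J hJ
      obtain ⟨P, -, rfl⟩ := Finset.mem_image.mp hJ
      exact h.isPrimary_isolatedComponent P
  · have hmem : Q.radical ∈ Q.minimalPrimes := by
      rw [minimalPrimes_eq_subsingleton hQ]; rfl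
    obtain ⟨n, hn⟩ := h.exists_pow_le ⟨Q.radical, hmem⟩
    refine ⟨n, hn.trans fun x hx => ?_⟩
    obtain ⟨u, hu, hux⟩ := mem_isolatedComponent.mp hx
    rw [mul_comm] at hux
    exact ((isPrimary_iff.mp hQ).2 hux).resolve_right hu

/-- At a maximal P the local factors are contracted. The contractions contain P^2, so their product
contains a power of P and is therefore determined by its localization at P. -/
lemma IsLocallyLevel.exists_prod_eq_isolatedComponent (h : IsLocallyLevel R) {I : Ideal R}
    (P : I.minimalPrimes) : ∃ s : Multiset (Ideal R),
      (∀ J ∈ s, IsNAbsorbing 2 J) ∧ s.prod = isolatedComponent I P := by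
  by_cases hP : P.1.IsMaximal
  swap
  · rw [isolatedComponent_eq_of_not_isMaximal h P hP]
    exact ⟨{P.1}, by simpa using isNAbsorbing_two_of_isPrime P.2.1.1, by simp⟩
  set f := algebraMap R (Localization.AtPrime P.1)
  have hPf : P.1.map f = maximalIdeal _ := IsLocalization.AtPrime.map_eq_maximalIdeal _ _
  have hfP : (maximalIdeal _).comap f = P.1 := IsLocalization.AtPrime.under_maximalIdeal _ _
  obtain ⟨n, hn⟩ := h.exists_pow_le_map P.2
  have hIm : I.map f ≤ maximalIdeal _ := hPf ▸ Ideal.map_mono P.2.1.2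
  have htop : I.map f ≠ ⊤ := fun ht =>
    (maximalIdeal.isMaximal (Localization.AtPrime P.1)).ne_top (top_le_iff.mp (ht ▸ hIm))
  obtain ⟨s, hs, hsI⟩ := (h P.1).exists_prod_eq htop hn
  have hle : ∀ J ∈ s, P.1 ^ 2 ≤ J.comap f ∧ J.comap f ≤ P.1 := fun J hJ => by
    constructor
    · rw [← map_le_iff_le_comap, Ideal.map_pow, hPf]
      exact (hs J hJ).1
    · exact (Ideal.comap_mono (hs J hJ).2).trans hfP.le
  refine ⟨s.map (Ideal.comap f), fun K hK => ?_, ?_⟩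
  · obtain ⟨J, hJ, rfl⟩ := Multiset.mem_map.mp hK
    exact isNAbsorbing_two_of_sq_le (hle J hJ).1 (hle J hJ).2
  have hmap : (s.map (Ideal.comap f)).prod.map f = I.map f := by
    rw [← hsI, ← Ideal.mapHom_apply, map_multiset_prod, Multiset.map_map]
    congr 1
    conv_rhs => rw [← Multiset.map_id s]
    exact Multiset.map_congr rfl fun J _ => IsLocalization.map_under P.1.primeCompl _ J
  have hpow : ∃ N, P.1 ^ N ≤ (s.map (Ideal.comap f)).prod := by
    clear hsI hmap hs
    induction s using Multiset.induction_on with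
    | empty => exact ⟨0, by simp⟩
    | cons J s ih =>
      obtain ⟨N, hN⟩ := ih fun K hK => hle K (Multiset.mem_cons_of_mem hK)
      refine ⟨2 + N, ?_⟩
      rw [pow_add, Multiset.map_cons, Multiset.prod_cons]
      exact Ideal.mul_mono (hle J (Multiset.mem_cons_self J s)).1 hN
  obtain ⟨N, hN⟩ := hpow
  refine le_antisymm ?_ fun x hx => ?_
  · rw [isolatedComponent, ← map_le_iff_le_comap]
    exact hmap.le
  · have hx' : f x ∈ I.map f := hx
    rw [← hmap, IsLocalization.algebraMap_mem_map_algebraMap_iff P.1.primeCompl] at hx'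
    obtain ⟨u, hu, hux⟩ := hx'
    exact mem_of_mul_mem_of_pow_le hN hu hux

theorem IsLocallyLevel.isTAFRing (h : IsLocallyLevel R)
    (hfin : ∀ I : Ideal R, I.minimalPrimes.Finite) : IsTAFRing R := by
  classical
  intro I _
  have := (hfin I).fintype
  choose s hs hsP using fun P => h.exists_prod_eq_isolatedComponent (I := I) P
  refine ⟨∑ P, s P, fun J hJ => ?_, ?_⟩
  · obtain ⟨P, -, hJP⟩ := Multiset.mem_sum.mp hJ
    exact hs P J hJP
  · rw [Multiset.prod_sum]
    simp only [hsP]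
    rw [Ideal.prod_eq_iInf_of_pairwise_isCoprime
      ((h.pairwise_isCoprime I).set_pairwise _)]
    simpa using h.iInf_isolatedComponent I

lemma IsFiniteAbsorbing.atPrime (h : IsFiniteAbsorbing R) (P : Ideal R) [P.IsPrime] :
    IsFiniteAbsorbing (Localization.AtPrime P) := by
  intro I hI
  obtain ⟨n, hn, hnI⟩ := h (I.comap (algebraMap R (Localization.AtPrime P))) (comap_ne_top _ hI)
  exact ⟨n, hn, hnI.of_comap_atPrime⟩

lemma IsFiniteAbsorbing.isLocallyLevel (h : IsFiniteAbsorbing R) (hL : IsLPVR R) :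
    IsLocallyLevel R := fun M _ => (hL M).isLevel_of_isFiniteAbsorbing (h.atPrime M)

lemma IsFiniteAbsorbing.finite_minimalPrimes (h : IsFiniteAbsorbing R) (I : Ideal R) :
    I.minimalPrimes.Finite := by
  by_cases hI : I = ⊤
  · simp [hI, Ideal.minimalPrimes_top]
  · obtain ⟨n, -, hn⟩ := h I hI
    exact hn.finite_minimalPrimes

/-- A substitute for Krull's intersection theorem, checked on each primary component Q of I + zM. If
M ⊆ rad Q, then Q contains some I + M^n; otherwise z m ∈ Q for some m ∈ M outside rad Q. -/
lemma IsStronglyLaskerian.mem_sup_span_mul (h : IsStronglyLaskerian R) {M I : Ideal R}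
    {z : R} (hz : ∀ n, z ∈ I ⊔ M ^ n) : z ∈ I ⊔ span {z} * M := by
  obtain ⟨s, hs, hprim⟩ := h.1 (I ⊔ span {z} * M)
  rw [← hs]
  refine (Submodule.mem_finsetInf).mpr fun (Q : Ideal R) hQ => ?_
  have hle : I ⊔ span {z} * M ≤ Q := hs ▸ Finset.inf_le hQ
  by_cases hMQ : M ≤ Q.radical
  · obtain ⟨n, hn⟩ := h.2 Q (hprim hQ)
    exact sup_le (le_sup_left.trans hle) ((Ideal.pow_right_mono hMQ n).trans hn) (hz n)
  · obtain ⟨m, hm, hmQ⟩ := SetLike.not_le_iff_exists.mp hMQ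
    exact ((isPrimary_iff.mp (hprim hQ)).2
      (hle (mem_sup_right (mul_mem_mul (mem_span_singleton_self z) hm)))).resolve_right hmQ

lemma IsStronglyLaskerian.isLevel_atPrime (h : IsStronglyLaskerian R) {M : Ideal R}
    [hM : M.IsMaximal]
    (hc : ∀ Q : Ideal R, Q.IsPrimary → Q.radical = M → Q ≤ M ^ 2 ∨ M ^ 2 ≤ Q) :
    IsLevel (Localization.AtPrime M) := by
  set f := algebraMap R (Localization.AtPrime M)
  have hMf : M.map f = maximalIdeal _ := IsLocalization.AtPrime.map_eq_maximalIdeal _ _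
  have hfm : ∀ x, f x ∈ maximalIdeal _ ↔ x ∈ M := fun x =>
    IsLocalization.AtPrime.to_map_mem_maximal_iff _ M x
  have hfp : ∀ x n, f x ∈ maximalIdeal _ ^ n ↔ x ∈ M ^ n := fun x n => by
    rw [← hMf, ← Ideal.map_pow, IsLocalization.algebraMap_mem_map_algebraMap_iff M.primeCompl]
    exact ⟨fun ⟨u, hu, hux⟩ => mem_of_mul_mem_of_pow_le le_rfl hu hux,
      fun hx => ⟨1, M.primeCompl.one_mem, by simpa using hx⟩⟩
  have hass : ∀ a : Localization.AtPrime M, ∃ r : R, Associated a (f r) := fun a => by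
    obtain ⟨⟨r, s⟩, hrs⟩ := IsLocalization.surj M.primeCompl a
    exact ⟨r, (IsLocalization.map_units _ s).unit, hrs⟩
  have hmem : ∀ (K : Ideal (Localization.AtPrime M)) {x y}, Associated x y → (x ∈ K ↔ y ∈ K) :=
    fun K x y hxy => ⟨fun h => K.mem_of_dvd hxy.dvd h, fun h => K.mem_of_dvd hxy.dvd' h⟩
  have hloc : ∀ (y z : R), (∀ n, z ∈ span {y} ⊔ M ^ n) → f z ∈ span {f y} := by
    intro y z hz
    have h1 := mem_map_of_mem f (h.mem_sup_span_mul hz)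
    rw [Ideal.map_sup, Ideal.map_mul, map_span, map_span, Set.image_singleton, Set.image_singleton,
      hMf] at h1
    obtain ⟨i, hi, k, hk, hik⟩ := Submodule.mem_sup.mp h1
    obtain ⟨m, hm, rfl⟩ := mem_span_singleton_mul.mp hk
    refine mem_of_mem_sup_span_mul hm ?_
    rw [← hik]
    exact add_mem (mem_sup_left hi) (by
      rw [hik]; exact mem_sup_right (mem_span_singleton_self _))
  refine .of_sq_le (fun y hy hy2 => ?_) fun x hx => ?_
  · obtain ⟨r, hr⟩ := hass y
    rw [hmem _ hr] at hy hy2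
    rw [hfm] at hy
    rw [hfp] at hy2
    refine le_trans ?_ (span_singleton_le_span_singleton.mpr hr.dvd)
    rw [← hMf, ← Ideal.map_pow, map_le_iff_le_comap]
    intro z hz
    refine hloc r z fun n => ?_
    -- The exponent n + 1 keeps this ideal proper even for n = 0. It is M-primary and not inside
    -- M^2, so it contains M^2.
    have hle : span {r} ⊔ M ^ (n + 1) ≤ M :=
      sup_le ((span_singleton_le_iff_mem _).mpr hy) (pow_le_self n.succ_ne_zero)
    have hrad : (span {r} ⊔ M ^ (n + 1)).radical = M :=
      le_antisymm ((radical_mono hle).trans hM.isPrime.radical.le)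
        fun x hx => ⟨n + 1, mem_sup_right (pow_mem_pow hx _)⟩
    rcases hc _ (isPrimary_of_isMaximal_radical (by rw [hrad]; exact hM)) hrad with h1 | h1
    · exact absurd (h1 (mem_sup_left (mem_span_singleton_self r))) hy2
    · have hle2 : span {r} ⊔ M ^ (n + 1) ≤ span {r} ⊔ M ^ n :=
        sup_le le_sup_left ((Ideal.pow_le_pow_right n.le_succ).trans le_sup_right)
      exact hle2 (h1 hz)
  · obtain ⟨r, hr⟩ := hass x
    have h0 : f r ∈ span {f 0} := hloc 0 r fun n => mem_sup_right
      ((hfp r n).mp ((hmem _ hr).mp (hx n)))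
    rw [map_zero, mem_span_singleton'] at h0
    obtain ⟨a, ha⟩ := h0
    rw [mul_zero] at ha
    rw [← ha] at hr
    exact (associated_zero_iff_eq_zero x).mp hr

end LocallyLevel

/-! ### Finite products of TAF-rings. -/

section Products

open Ideal

/-- In general the two sides differ by the kernel; an idempotent kernel is absorbed by the product
of the preimages. -/
lemma comap_mul_of_surjective_of_ker_le {A B : Type*} [CommRing A] [CommRing B] {f : A →+* B}
    (hf : Function.Surjective f) (hker : RingHom.ker f ≤ RingHom.ker f * RingHom.ker f)
    (I J : Ideal B) : (I * J).comap f = I.comap f * J.comap f := by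
  refine le_antisymm ?_ (le_comap_mul f)
  have h1 : I * J = (I.comap f * J.comap f).map f := by
    rw [Ideal.map_mul, map_comap_of_surjective f hf, map_comap_of_surjective f hf]
  conv_lhs => rw [h1]
  rw [comap_map_of_surjective' f hf]
  exact sup_le le_rfl (hker.trans (Ideal.mul_mono (ker_le_comap f) (ker_le_comap f)))

variable {ι : Type*} {S : ι → Type*} [∀ i, CommRing (S i)]

lemma ker_evalRingHom_le_sq (i : ι) : RingHom.ker (Pi.evalRingHom S i) ≤
    RingHom.ker (Pi.evalRingHom S i) * RingHom.ker (Pi.evalRingHom S i) := by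
  classical
  intro x hx
  have h1 : x = x * (1 - Pi.single i 1) := by
    ext j
    by_cases hj : j = i
    · subst hj
      have : x j = 0 := hx
      simp [this]
    · simp [hj]
  rw [h1]
  exact mul_mem_mul hx (by simp [RingHom.mem_ker])

lemma isCoprime_comap_evalRingHom {i j : ι} (hij : i ≠ j) (I : Ideal (S i)) (J : Ideal (S j)) :
    IsCoprime (I.comap (Pi.evalRingHom S i)) (J.comap (Pi.evalRingHom S j)) := by
  classical
  rw [isCoprime_iff_exists]
  refine ⟨1 - Pi.single i 1, ?_, Pi.single i 1, ?_, by ring⟩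
  · simp [mem_comap]
  · simp [mem_comap, hij.symm]

lemma iInf_comap_map_evalRingHom [Fintype ι] (I : Ideal (∀ i, S i)) :
    ⨅ i, (I.map (Pi.evalRingHom S i)).comap (Pi.evalRingHom S i) = I := by
  classical
  refine le_antisymm (fun x hx => ?_) (le_iInf fun i => le_comap_map)
  rw [mem_iInf] at hx
  have hsurj : ∀ i, Function.Surjective (Pi.evalRingHom S i) := fun i => Function.surjective_eval i
  choose y hy hyx using fun i => (mem_map_iff_of_surjective _ (hsurj i)).mp (hx i)
  have h1 : x = ∑ i, Pi.single i 1 * y i := by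
    ext j
    rw [Finset.sum_apply, Finset.sum_eq_single j]
    · simpa using (hyx j).symm
    · intro i _ hij
      simp [hij.symm]
    · simp
  rw [h1]
  exact I.sum_mem fun i _ => I.mul_mem_left _ (hy i)

lemma IsNAbsorbing.comap_two {A B : Type*} [CommRing A] [CommRing B] (f : A →+* B) {J : Ideal B}
    (h : IsNAbsorbing 2 J) : IsNAbsorbing 2 (J.comap f) := by
  rw [isNAbsorbing_two_iff] at h ⊢
  intro a b c habc
  simp only [mem_comap, map_mul] at habc ⊢
  exact h _ _ _ habc

lemma multiset_prod_map_comap {A B : Type*} [CommRing A] [CommRing B] {f : A →+* B}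
    (hf : Function.Surjective f) (hker : RingHom.ker f ≤ RingHom.ker f * RingHom.ker f)
    (s : Multiset (Ideal B)) : (s.map (Ideal.comap f)).prod = s.prod.comap f := by
  induction s using Multiset.induction_on with
  | empty => simp [Ideal.one_eq_top, comap_top]
  | cons J s ih =>
    rw [Multiset.map_cons, Multiset.prod_cons, Multiset.prod_cons, ih,
      comap_mul_of_surjective_of_ker_le hf hker]

theorem IsTAFRing.pi [Fintype ι] (h : ∀ i, IsTAFRing (S i)) : IsTAFRing (∀ i, S i) := by
  classical
  intro I _
  have hex : ∀ i, ∃ s : Multiset (Ideal (S i)), (∀ J ∈ s, IsNAbsorbing 2 J) ∧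
      s.prod = I.map (Pi.evalRingHom S i) := fun i => by
    by_cases ht : I.map (Pi.evalRingHom S i) = ⊤
    · exact ⟨0, by simp, by rw [ht, Multiset.prod_zero, one_eq_top]⟩
    · exact h i _ ht
  choose s hs hsI using hex
  refine ⟨∑ i, (s i).map (Ideal.comap (Pi.evalRingHom S i)), fun J hJ => ?_, ?_⟩
  · obtain ⟨i, -, hi⟩ := Multiset.mem_sum.mp hJ
    obtain ⟨K, hK, rfl⟩ := Multiset.mem_map.mp hi
    exact (hs i K hK).comap_two _
  · rw [Multiset.prod_sum]
    have : ∀ i, ((s i).map (Ideal.comap (Pi.evalRingHom S i))).prod =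
        (I.map (Pi.evalRingHom S i)).comap (Pi.evalRingHom S i) := fun i => by
      rw [← hsI]
      exact multiset_prod_map_comap (f := Pi.evalRingHom S i) (Function.surjective_eval i)
        (ker_evalRingHom_le_sq i) (s i)
    simp only [this]
    rw [Ideal.prod_eq_iInf_of_pairwise_isCoprime
      (fun i _ j _ hij => isCoprime_comap_evalRingHom hij _ _)]
    simpa using iInf_comap_map_evalRingHom I

end Products

/-! ### Level domains, PVDs and strongly prime maximal ideals. -/

section PseudoValuationDomains

open IsLocalRing Ideal

variable {A : Type*} [CommRing A] [IsLocalRing A]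

lemma IsLevel.isPVD [IsDomain A] (h : IsLevel A) : IsPVD A := by
  refine ⟨inferInstance, fun P hP x y hxy => ?_⟩
  set φ := algebraMap A (FractionRing A)
  have hinj : Function.Injective φ := IsFractionRing.injective A (FractionRing A)
  obtain ⟨w, hw, hwxy⟩ := hxy
  rcases h.eq_bot_or_eq_maximalIdeal hP with rfl | rfl
  · have hw0 : w = 0 := hw
    rw [hw0, map_zero] at hwxy
    exact (mul_eq_zero.mp hwxy.symm).imp (fun h => ⟨0, rfl, by rw [h, map_zero]⟩)
      fun h => ⟨0, rfl, by rw [h, map_zero]⟩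
  · obtain ⟨a, b, hb, rfl⟩ := IsFractionRing.div_surjective (A := A) x
    have hb0 : φ b ≠ 0 := fun h0 => nonZeroDivisors.ne_zero hb (hinj (by rw [h0, map_zero]))
    -- With x = a/b, either a ∈ b m and x ∈ m, or b w is a multiple a e and y = e lies in the ring.
    -- In the latter case, if e is a unit then x = w/e lies in m.
    rcases h.isStronglyPrime.comparable b a with h1 | h1
    · left
      obtain ⟨z, hz, rfl⟩ := mem_span_singleton_mul.mp h1
      exact ⟨z, hz, by rw [map_mul, mul_div_cancel_left₀ _ hb0]⟩
    · by_cases ha : a = 0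
      · left
        exact ⟨0, zero_mem _, by simp [ha]⟩
      have ha0 : φ a ≠ 0 := fun h0 => ha (hinj (by rw [h0, map_zero]))
      obtain ⟨e, he⟩ := h1 w hw
      have hy : y = φ e := by
        have h2 := congrArg φ he
        rw [map_mul, map_mul, hwxy, ← mul_assoc, mul_div_cancel₀ _ hb0] at h2
        exact mul_left_cancel₀ ha0 h2
      by_cases hem : e ∈ maximalIdeal A
      · exact .inr ⟨e, hem, hy.symm⟩
      · left
        obtain ⟨v, hv⟩ := notMem_maximalIdeal.mp hem
        refine ⟨w * ↑v⁻¹, mul_mem_right _ _ hw, ?_⟩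
        rw [map_mul, hwxy, hy, mul_assoc, ← map_mul, ← hv, Units.mul_inv, map_one, mul_one]

lemma IsPVD.isStronglyPrime (h : IsPVD A) : IsStronglyPrime (maximalIdeal A) := by
  obtain ⟨hD, h⟩ := h
  refine ⟨inferInstance, fun a b => ?_⟩
  set φ := algebraMap A (FractionRing A)
  have hinj : Function.Injective φ := IsFractionRing.injective A (FractionRing A)
  by_cases hb : b ∈ span {a} * maximalIdeal A
  · exact .inr ((span_singleton_le_iff_mem _).mpr hb)
  left
  have hb0 : φ b ≠ 0 := fun h0 => hb (by
    rw [hinj (h0.trans (map_zero φ).symm)]; exact zero_mem _)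
  rw [span_singleton_mul_le_iff]
  intro m hm
  by_cases ha : a = 0
  · simp [ha]
  have ha0 : φ a ≠ 0 := fun h0 => ha (hinj (by rw [h0, map_zero]))
  -- The factorization m = (b/a)(m a/b) is tested: the first factor cannot lie in the maximal ideal
  -- because b ∉ a m.
  rcases h (maximalIdeal A) inferInstance (φ b / φ a) (φ m * φ a / φ b)
    ⟨m, hm, by field_simp⟩ with ⟨z, hz, hzx⟩ | ⟨z, hz, hzx⟩
  · refine absurd (mem_span_singleton_mul.mpr ⟨z, hz, hinj ?_⟩) hb
    rw [map_mul]
    change φ z = _ at hzx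
    rw [hzx, mul_div_cancel₀ _ ha0]
  · refine mem_span_singleton'.mpr ⟨z, hinj ?_⟩
    change φ z = _ at hzx
    rw [map_mul, map_mul, hzx, div_mul_cancel₀ _ hb0, mul_comm]

end PseudoValuationDomains

/-! ### Divisorial ideals expressed by divisibility. -/

section Divisorial

variable {D : Type*} [CommRing D] [IsDomain D]

/-- A fraction b/c lies in R : I exactly when c divides b i for all i ∈ I, which rewrites the double
residual inside D. -/
lemma mem_one_div_one_div_iff {I : Ideal D} (hI : I ≠ ⊥) (y : D) :
    algebraMap D (FractionRing D) y ∈ 1 / (1 / (I : FractionalIdeal D⁰ (FractionRing D))) ↔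
      ∀ b c : D, c ≠ 0 → (∀ i ∈ I, c ∣ b * i) → c ∣ b * y := by
  set φ := algebraMap D (FractionRing D)
  have hinj : Function.Injective φ := IsFractionRing.injective D (FractionRing D)
  have hI0 : (I : FractionalIdeal D⁰ (FractionRing D)) ≠ 0 :=
    FractionalIdeal.coeIdeal_ne_zero.mpr hI
  have hdvd : ∀ b c i : D, c ≠ 0 →
      (φ b / φ c * φ i ∈ (1 : FractionalIdeal D⁰ (FractionRing D)) ↔ c ∣ b * i) := by
    intro b c i hc
    have hc0 : φ c ≠ 0 := fun h0 => hc (hinj (by rw [h0, map_zero]))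
    rw [FractionalIdeal.mem_one_iff]
    constructor
    · rintro ⟨r, hr⟩
      refine ⟨r, hinj ?_⟩
      change φ r = _ at hr
      rw [map_mul, map_mul, hr]; field_simp
    · rintro ⟨r, hr⟩
      refine ⟨r, ?_⟩
      have := congrArg φ hr
      rw [map_mul, map_mul] at this
      change φ r = _
      field_simp
      linear_combination -this
  have hmem : ∀ b c : D, c ≠ 0 →
      (φ b / φ c ∈ 1 / (I : FractionalIdeal D⁰ (FractionRing D)) ↔ ∀ i ∈ I, c ∣ b * i) := by
    intro b c hc
    rw [FractionalIdeal.mem_div_iff_of_ne_zero hI0]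
    constructor
    · intro h i hi
      exact (hdvd b c i hc).mp (h _ ((FractionalIdeal.mem_coeIdeal_of_mem _ hi)))
    · intro h z hz
      obtain ⟨i, hi, rfl⟩ := (FractionalIdeal.mem_coeIdeal _).mp hz
      exact (hdvd b c i hc).mpr (h i hi)
  have h1 : (1 / (I : FractionalIdeal D⁰ (FractionRing D))) ≠ 0 := by
    intro h0
    have := (hmem 1 1 one_ne_zero).mpr fun i _ => one_dvd _
    rw [h0, FractionalIdeal.mem_zero_iff] at this
    simp at this
  rw [FractionalIdeal.mem_div_iff_of_ne_zero h1]
  constructor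
  · intro h b c hc hbc
    have := h _ ((hmem b c hc).mpr hbc)
    rw [mul_comm] at this
    exact (hdvd b c y hc).mp this
  · intro h z hz
    obtain ⟨b, c, hc, rfl⟩ := IsFractionRing.div_surjective (A := D) z
    have hc0 := nonZeroDivisors.ne_zero hc
    rw [mul_comm]
    exact (hdvd b c y hc0).mpr (h b c hc0 ((hmem b c hc0).mp hz))

lemma isDivisorial_iff {I : Ideal D} : IsDivisorial I ↔ I ≠ ⊥ ∧
    ∀ y : D, (∀ b c : D, c ≠ 0 → (∀ i ∈ I, c ∣ b * i) → c ∣ b * y) → y ∈ I := by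
  refine and_congr_right fun hI => ⟨fun h y hy => ?_, fun h => ?_⟩
  · rw [← mem_one_div_one_div_iff hI, h, FractionalIdeal.mem_coeIdeal] at hy
    obtain ⟨i, hi, hiy⟩ := hy
    rwa [← IsFractionRing.injective D (FractionRing D) hiy]
  · have hmem : ∀ y ∈ I, algebraMap D (FractionRing D) y ∈
        1 / (1 / (I : FractionalIdeal D⁰ (FractionRing D))) := fun y hy =>
      (mem_one_div_one_div_iff hI y).mpr fun b c _ hbc => hbc y hy
    have hI0 : (I : FractionalIdeal D⁰ (FractionRing D)) ≠ 0 :=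
      FractionalIdeal.coeIdeal_ne_zero.mpr hI
    -- As 1 ∈ R : I, the double residual lies in D, so testing elements of D is enough.
    have h1 : (1 : FractionRing D) ∈ 1 / (I : FractionalIdeal D⁰ (FractionRing D)) := by
      rw [FractionalIdeal.mem_div_iff_of_ne_zero hI0]
      intro z hz
      rw [one_mul]
      exact FractionalIdeal.coeIdeal_le_one hz
    have h10 : (1 / (I : FractionalIdeal D⁰ (FractionRing D))) ≠ 0 := by
      intro h0
      rw [h0, FractionalIdeal.mem_zero_iff] at h1
      exact one_ne_zero h1
    refine le_antisymm (fun z hz => ?_) fun z hz => ?_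
    · have h2 := (FractionalIdeal.mem_div_iff_of_ne_zero h10).mp hz 1 h1
      rw [mul_one] at h2
      obtain ⟨y, rfl⟩ := (FractionalIdeal.mem_one_iff _).mp h2
      exact FractionalIdeal.mem_coeIdeal_of_mem _
        (h y ((mem_one_div_one_div_iff hI y).mp hz))
    · obtain ⟨y, hy, rfl⟩ := (FractionalIdeal.mem_coeIdeal _).mp hz
      exact hmem y hy

end Divisorial

/-! ### Passage of level localizations to quotients. -/

section Surjections

open IsLocalRing Ideal

variable {R : Type*} [CommRing R]

/-- Levelness passes from a localization of `R` to any local ring of fractions of a quotient. -/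
lemma IsLevel.of_forall_isUnit {P : Ideal R} [P.IsPrime] (h : IsLevel (Localization.AtPrime P))
    {B : Type*} [CommRing B] [IsLocalRing B] {g : R →+* B} (hg : ∀ u ∉ P, IsUnit (g u))
    (hsurj : ∀ b : B, ∃ x, ∃ u ∉ P, b * g u = g x) : IsLevel B := by
  refine h.of_surjective (f := IsLocalization.lift (M := P.primeCompl) (g := g)
    fun u => hg u u.2) ?_
  rw [IsLocalization.lift_surjective_iff]
  intro b
  obtain ⟨x, u, hu, hb⟩ := hsurj b
  exact ⟨⟨x, ⟨u, hu⟩⟩, hb⟩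

lemma IsLocallyLevel.of_surjective {B : Type*} [CommRing B] (h : IsLocallyLevel R) {g : R →+* B}
    (hg : Function.Surjective g) : IsLocallyLevel B := by
  intro N hN
  have : (N.comap g).IsMaximal := comap_isMaximal_of_surjective g hg
  refine (h (N.comap g)).of_forall_isUnit
    (g := (algebraMap B (Localization.AtPrime N)).comp g) (fun u hu => ?_) fun b => ?_
  · exact IsLocalization.map_units (Localization.AtPrime N) (⟨g u, hu⟩ : N.primeCompl)
  · obtain ⟨⟨x, s⟩, hxs⟩ := IsLocalization.surj N.primeCompl b
    obtain ⟨x, rfl⟩ := hg x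
    obtain ⟨u, hu⟩ := hg s
    exact ⟨x, u, fun hu' => s.2 (hu ▸ hu'), by simpa [hu] using hxs⟩

lemma finite_minimalPrimes_of_surjective {B : Type*} [CommRing B]
    (h : ∀ I : Ideal R, I.minimalPrimes.Finite) {g : R →+* B} (hg : Function.Surjective g)
    (J : Ideal B) : J.minimalPrimes.Finite := by
  have := h (J.comap g)
  rw [comap_minimalPrimes_eq_of_surjective hg] at this
  exact this.of_finite_image (comap_injective_of_surjective g hg).injOn

/-- The quotient by an isolated component at a maximal ideal is a level local ring. -/
lemma IsLocallyLevel.quotient_isolatedComponent (h : IsLocallyLevel R) {I : Ideal R}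
    (P : I.minimalPrimes) (hP : P.1.IsMaximal) :
    ∃ _ : IsLocalRing (R ⧸ isolatedComponent I P), IsLevel (R ⧸ isolatedComponent I P) := by
  obtain ⟨n, hn⟩ := h.exists_pow_le P
  have hne : isolatedComponent I P ≠ ⊤ := fun ht =>
    hP.ne_top (top_le_iff.mp (ht ▸ isolatedComponent_le I P))
  have : Nontrivial (R ⧸ isolatedComponent I P) := Quotient.nontrivial_iff.mpr hne
  have hunit : ∀ u ∉ P.1, IsUnit (Ideal.Quotient.mk (isolatedComponent I P) u) := by
    intro u hu
    have h1 : span {u} ⊔ P.1 = ⊤ := by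
      rw [sup_comm]
      exact hP.1.2 _ (left_lt_sup.mpr fun h => hu ((span_singleton_le_iff_mem _).mp h))
    have h2 : span {u} ⊔ P.1 ^ n = ⊤ := sup_pow_eq_top h1
    obtain ⟨a, ha, b, hb, hab⟩ := Submodule.mem_sup.mp (h2 ▸ Submodule.mem_top : (1 : R) ∈ _)
    obtain ⟨r, rfl⟩ := mem_span_singleton'.mp ha
    refine IsUnit.of_mul_eq_one (Ideal.Quotient.mk _ r) ?_
    rw [← map_mul, mul_comm, ← sub_eq_zero, ← map_one (Ideal.Quotient.mk _), ← map_sub,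
      Ideal.Quotient.eq_zero_iff_mem]
    have : r * u - 1 = -b := by linear_combination hab
    rw [this]
    exact neg_mem (hn hb)
  let f : Localization.AtPrime P.1 →+* R ⧸ isolatedComponent I P :=
    IsLocalization.lift (M := P.1.primeCompl) (g := Ideal.Quotient.mk (isolatedComponent I P))
      fun u => hunit u u.2
  have hf : Function.Surjective f := by
    intro b
    obtain ⟨x, rfl⟩ := Ideal.Quotient.mk_surjective b
    exact ⟨algebraMap _ _ x, IsLocalization.lift_eq _ x⟩
  have hloc : IsLocalRing (R ⧸ isolatedComponent I P) := IsLocalRing.of_surjective' f hf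
  exact ⟨hloc, (h P.1).of_surjective hf⟩

end Surjections

/-! ### Domains with level localizations are Mori when minimal primes are finite in number. -/

section ToMori

open IsLocalRing Ideal

/-- Two elements of S determine its residuals. Take x ∈ S outside the smallest possible power of m,
and y ∈ S not divisible by x, if any. From b x = c e and c ∣ b y, e must be a nonunit, so w e ∈
m^(k+1) = x m for w ∈ S, and cancelling x gives c ∣ b w. -/
lemma IsLevel.exists_pair {A : Type*} [CommRing A] [IsDomain A] [IsLocalRing A] (h : IsLevel A)
    {S : Set A} (hS : ∃ s ∈ S, s ≠ 0) :
    ∃ x ∈ S, ∃ y ∈ S, ∀ b c : A, c ≠ 0 → c ∣ b * x → c ∣ b * y → ∀ w ∈ S, c ∣ b * w := by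
  classical
  obtain ⟨s, hs, hs0⟩ := hS
  have hex : ∃ n, ∃ x ∈ S, x ∉ maximalIdeal A ^ n := by
    obtain ⟨k, -, hk⟩ := h s hs0
    exact ⟨k + 1, s, hs, notMem_pow_succ hs0 hk⟩
  obtain ⟨k, hk⟩ : ∃ k, Nat.find hex = k + 1 := by
    refine Nat.exists_eq_succ_of_ne_zero fun h0 => ?_
    have := Nat.find_spec hex
    rw [h0] at this
    simp at this
  have hSk : ∀ x ∈ S, x ∈ maximalIdeal A ^ k := by
    intro x hx
    by_contra hxk
    have := Nat.find_min' hex ⟨x, hx, hxk⟩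
    lia
  obtain ⟨x, hx, hxk⟩ := Nat.find_spec hex
  rw [hk] at hxk
  have hxm := h.span_mul_eq (hSk x hx) hxk
  have hx0 : x ≠ 0 := by rintro rfl; exact hxk (zero_mem _)
  by_cases hdvd : ∀ y ∈ S, x ∣ y
  · refine ⟨x, hx, x, hx, fun b c _ hbx _ w hw => ?_⟩
    obtain ⟨r, rfl⟩ := hdvd w hw
    rw [← mul_assoc]
    exact hbx.mul_right r
  · push Not at hdvd
    obtain ⟨y, hy, hxy⟩ := hdvd
    refine ⟨x, hx, y, hy, fun b c hc hbx hby w hw => ?_⟩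
    obtain ⟨e, he⟩ := hbx
    obtain ⟨g, hg⟩ := hby
    have hem : e ∈ maximalIdeal A := by
      by_contra hem
      refine hxy (((notMem_maximalIdeal.mp hem).dvd_mul_left (a := x)).mp ⟨g, ?_⟩)
      apply mul_left_cancel₀ hc
      linear_combination (-y) * he + x * hg
    have hwe : w * e ∈ span {x} * maximalIdeal A := by
      rw [hxm, pow_succ]
      exact mul_mem_mul (hSk w hw) hem
    obtain ⟨e', -, he'⟩ := mem_span_singleton_mul.mp hwe
    refine ⟨e', mul_left_cancel₀ hx0 ?_⟩
    linear_combination w * he - c * he'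

variable {D : Type*} [CommRing D] [IsDomain D]

lemma IsLocallyLevel.isMaximal_of_mem (h : IsLocallyLevel D) {P : Ideal D} (hP : P.IsPrime) {x : D}
    (hx : x ≠ 0) (hxP : x ∈ P) : P.IsMaximal := by
  obtain ⟨M, hM, hPM⟩ := exists_le_maximal P hP.ne_top
  by_cases hPe : P = M
  · rwa [hPe]
  · obtain ⟨u, hu, hux⟩ := h.exists_mul_eq_zero hP hPM hPe hxP
    have : u = 0 := (mul_eq_zero.mp hux).resolve_right hx
    exact absurd (this ▸ M.zero_mem) hu

lemma IsLocallyLevel.mem_minimalPrimes_span (h : IsLocallyLevel D) {M : Ideal D} (hM : M.IsMaximal)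
    {x : D} (hx : x ≠ 0) (hxM : x ∈ M) : M ∈ (span {x}).minimalPrimes := by
  refine ⟨⟨hM.isPrime, (span_singleton_le_iff_mem _).mpr hxM⟩, fun P hP hPM => ?_⟩
  exact ((h.isMaximal_of_mem hP.1 hx ((span_singleton_le_iff_mem _).mp hP.2)).eq_of_le
    hM.ne_top hPM).ge

lemma IsLocallyLevel.exists_finset (h : IsLocallyLevel D)
    (hfin : ∀ I : Ideal D, I.minimalPrimes.Finite) {I : Ideal D} (hI : I ≠ ⊥) :
    ∃ T : Finset D, (∀ t ∈ T, t ∈ I) ∧ ∀ b c : D, c ≠ 0 → (∀ t ∈ T, c ∣ b * t) →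
      ∀ i ∈ I, c ∣ b * i := by
  classical
  obtain ⟨x, hx, hx0⟩ := Submodule.exists_mem_ne_zero_of_ne_bot hI
  have hloc : ∀ M : Ideal D, M.IsMaximal → ∃ y ∈ I, ∃ z ∈ I, ∀ b c : D, c ≠ 0 →
      c ∣ b * y → c ∣ b * z → ∀ i ∈ I, ∃ u ∉ M, c ∣ u * (b * i) := by
    intro M hM
    set f := algebraMap D (Localization.AtPrime M)
    have hDM : IsDomain (Localization.AtPrime M) :=
      IsLocalization.isDomain_localization M.primeCompl_le_nonZeroDivisors
    have hinj : Function.Injective f :=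
      IsLocalization.injective _ M.primeCompl_le_nonZeroDivisors
    obtain ⟨y', ⟨y, hy, rfl⟩, z', ⟨z, hz, rfl⟩, hyz⟩ := (h M).exists_pair (S := f '' I)
      ⟨f x, ⟨x, hx, rfl⟩, fun h0 => hx0 (hinj (by rw [h0, map_zero]))⟩
    refine ⟨y, hy, z, hz, fun b c hc hby hbz i hi => ?_⟩
    have h1 := hyz (f b) (f c) (fun h0 => hc (hinj (by rw [h0, map_zero])))
      (by rw [← map_mul]; exact map_dvd f hby) (by rw [← map_mul]; exact map_dvd f hbz)
      (f i) ⟨i, hi, rfl⟩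
    rw [← map_mul, ← mem_span_singleton, ← Set.image_singleton, ← map_span,
      IsLocalization.algebraMap_mem_map_algebraMap_iff M.primeCompl] at h1
    obtain ⟨u, hu, hux⟩ := h1
    exact ⟨u, hu, mem_span_singleton.mp hux⟩
  choose! y hy z hz hyz using hloc
  let F := (hfin (span {x})).toFinset.filter fun M => M.IsMaximal
  refine ⟨insert x (F.image y ∪ F.image z), fun t ht => ?_, fun b c hc hbc i hi => ?_⟩
  · simp only [Finset.mem_insert, Finset.mem_union, Finset.mem_image, F, Finset.mem_filter] at ht
    rcases ht with rfl | ⟨M, hM, rfl⟩ | ⟨M, hM, rfl⟩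
    exacts [hx, hy M hM.2, hz M hM.2]
  · let A : Ideal D := Submodule.comap (LinearMap.mulRight D (b * i)) (span {c})
    have hA : ∀ r, r ∈ A ↔ c ∣ r * (b * i) := fun r => by
      simp [A, mem_span_singleton, mul_assoc]
    by_contra hcon
    have hAt : A ≠ ⊤ := fun ht => hcon (by
      have := (hA 1).mp (ht ▸ Submodule.mem_top)
      rwa [one_mul] at this)
    obtain ⟨M, hM, hAM⟩ := exists_le_maximal A hAt
    -- Including x in T puts it in A, so any maximal ideal above A is one of the finitely many
    -- minimal primes of xD treated by F.
    have hxM : x ∈ M := hAM ((hA x).mpr (by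
      have := (hbc x (Finset.mem_insert_self _ _)).mul_right i
      rwa [show x * (b * i) = b * x * i by ring]))
    have hMF : M ∈ F := by
      simp only [F, Finset.mem_filter, Set.Finite.mem_toFinset]
      exact ⟨h.mem_minimalPrimes_span hM hx0 hxM, hM⟩
    obtain ⟨u, hu, hux⟩ := hyz M hM b c hc
      (hbc _ (Finset.mem_insert_of_mem (Finset.mem_union_left _ (Finset.mem_image_of_mem y hMF))))
      (hbc _ (Finset.mem_insert_of_mem (Finset.mem_union_right _ (Finset.mem_image_of_mem z hMF))))
      i hi
    exact hu (hAM ((hA u).mpr hux))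

/-- A finite set with the same residuals as the union of the chain already lies in some I N; being
divisorial, I N then contains the whole union. -/
theorem IsLocallyLevel.isMoriDomain (h : IsLocallyLevel D)
    (hfin : ∀ I : Ideal D, I.minimalPrimes.Finite) : IsMoriDomain D := by
  refine ⟨inferInstance, fun I hmono hdiv => ?_⟩
  have hmem : ∀ x, x ∈ ⨆ n, I n ↔ ∃ n, x ∈ I n := fun x =>
    Submodule.mem_iSup_of_directed I hmono.directed_le
  have hne : ⨆ n, I n ≠ ⊥ := fun h0 => (hdiv 0).1 (eq_bot_iff.mpr (h0 ▸ le_iSup I 0))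
  obtain ⟨T, hTI, hT⟩ := h.exists_finset hfin hne
  obtain ⟨N, hN⟩ : ∃ N, ∀ t ∈ T, t ∈ I N := by
    clear hT
    classical
    induction T using Finset.induction_on with
    | empty => exact ⟨0, by simp⟩
    | insert a T ha ih =>
      obtain ⟨N, hN⟩ := ih fun t ht => hTI t (Finset.mem_insert_of_mem ht)
      obtain ⟨m, hm⟩ := (hmem a).mp (hTI a (Finset.mem_insert_self a T))
      refine ⟨max N m, fun t ht => ?_⟩
      rcases Finset.mem_insert.mp ht with rfl | ht
      exacts [hmono (le_max_right N m) hm, hmono (le_max_left N m) (hN t ht)]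
  refine ⟨N, fun m hm => le_antisymm (fun y hy => ?_) (hmono hm)⟩
  refine (isDivisorial_iff.mp (hdiv N)).2 y fun b c hc hbc => ?_
  exact hT b c hc (fun t ht => hbc t (hN t ht)) y ((hmem y).mpr ⟨m, hy⟩)

lemma IsLocallyLevel.isLPVD (h : IsLocallyLevel D) : IsLPVD D := by
  refine ⟨inferInstance, fun M _ => ?_⟩
  have : IsDomain (Localization.AtPrime M) :=
    IsLocalization.isDomain_localization M.primeCompl_le_nonZeroDivisors
  exact (h M).isPVD

end ToMori

/-! ### Mori domains with pseudo-valuation localizations are TAF-rings. -/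

section FromMori

open IsLocalRing Ideal

variable {D : Type*} [CommRing D]

/-- The ideal of all `r` with `r A ⊆ x D`. -/
def residual (x : D) (A : Set D) : Ideal D where
  carrier := {r | ∀ a ∈ A, x ∣ a * r}
  zero_mem' := fun a _ => by simp
  add_mem' := fun {r s} hr hs a ha => by rw [mul_add]; exact dvd_add (hr a ha) (hs a ha)
  smul_mem' := fun c r hr a ha => by
    rw [smul_eq_mul, mul_left_comm]; exact (hr a ha).mul_left c

lemma mem_residual {x r : D} {A : Set D} : r ∈ residual x A ↔ ∀ a ∈ A, x ∣ a * r := Iff.rfl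

lemma mem_residual_singleton {x r a : D} : r ∈ residual x {a} ↔ x ∣ a * r := by
  simp [mem_residual]

variable [IsDomain D]

lemma isDivisorial_residual {x : D} (hx : x ≠ 0) (A : Set D) : IsDivisorial (residual x A) := by
  rw [isDivisorial_iff]
  refine ⟨fun h0 => hx ?_, fun y hy a ha => hy a x hx fun i hi => hi a ha⟩
  have : x ∈ residual x A := fun a _ => dvd_mul_left x a
  rwa [h0, Submodule.mem_bot] at this

lemma IsMoriDomain.wellFoundedGT (h : IsMoriDomain D) :
    WellFoundedGT {I : Ideal D // IsDivisorial I} := by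
  obtain ⟨_, h⟩ := h
  rw [wellFoundedGT_iff_monotone_chain_condition]
  intro a
  obtain ⟨n, hn⟩ := h (fun k => (a k).1) (fun i j hij => a.monotone hij) (fun k => (a k).2)
  exact ⟨n, fun m hm => Subtype.ext (hn m hm).symm⟩

/-- In a Mori domain, the contraction of a nonzero principal ideal of a localization is a residual
of a principal ideal. -/
lemma IsMoriDomain.exists_comap_span_eq (h : IsMoriDomain D) (M : Ideal D) [hM : M.IsPrime] {x : D}
    (hx : x ≠ 0) : ∃ s ∉ M, (span {algebraMap D (Localization.AtPrime M) x}).comap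
      (algebraMap D (Localization.AtPrime M)) = residual x {s} := by
  have hwf := h.wellFoundedGT
  let J : D → {I : Ideal D // IsDivisorial I} := fun s =>
    ⟨residual x {s}, isDivisorial_residual hx _⟩
  -- Choose s outside M with xD : s maximal. Multiplying s by another u ∉ M cannot enlarge it, so
  -- all denominators are already accounted for.
  obtain ⟨m, ⟨s, hs, rfl⟩, hmax⟩ := hwf.wf.has_min (J '' {s | s ∉ M})
    ⟨J 1, 1, hM.one_notMem, rfl⟩
  refine ⟨s, hs, ?_⟩
  ext t
  rw [mem_comap, ← Set.image_singleton, ← map_span,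
    IsLocalization.algebraMap_mem_map_algebraMap_iff M.primeCompl, mem_residual_singleton]
  constructor
  · rintro ⟨u, hu, hut⟩
    have hut' := mem_span_singleton.mp hut
    have hle : J s ≤ J (s * u) := fun r hr => by
      have hr' := mem_residual_singleton.mp hr
      refine mem_residual_singleton.mpr ?_
      rw [mul_right_comm]
      exact hr'.mul_right u
    have heq : J s = J (s * u) := by
      by_contra hne
      exact hmax _ ⟨s * u, fun hm => (hM.mem_or_mem hm).elim hs hu, rfl⟩ (lt_of_le_of_ne hle hne)
    have ht : t ∈ (J (s * u)).1 := mem_residual_singleton.mpr (by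
      rw [mul_assoc]; exact hut'.mul_left s)
    rw [← heq] at ht
    exact mem_residual_singleton.mp ht
  · intro hst
    exact ⟨s, hs, mem_span_singleton.mpr hst⟩

lemma exists_associated_algebraMap {D : Type*} [CommRing D] (M : Ideal D) [M.IsPrime] (a : Localization.AtPrime M) :
    ∃ r : D, Associated a (algebraMap D (Localization.AtPrime M) r) := by
  obtain ⟨⟨r, s⟩, hrs⟩ := IsLocalization.surj M.primeCompl a
  exact ⟨r, (IsLocalization.map_units _ s).unit, hrs⟩

lemma IsMoriDomain.isDivisorial_comap (h : IsMoriDomain D) (M : Ideal D) [M.IsPrime]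
    {y : Localization.AtPrime M} (hy : y ≠ 0) :
    IsDivisorial ((span {y}).comap (algebraMap D (Localization.AtPrime M))) := by
  have : IsDomain (Localization.AtPrime M) :=
    IsLocalization.isDomain_localization M.primeCompl_le_nonZeroDivisors
  obtain ⟨r, hr⟩ := exists_associated_algebraMap M y
  have hr0 : r ≠ 0 := by
    rintro rfl
    rw [map_zero] at hr
    exact hy ((associated_zero_iff_eq_zero y).mp hr)
  obtain ⟨s, -, hs⟩ := h.exists_comap_span_eq M hr0
  rw [span_singleton_eq_span_singleton.mpr hr, hs]
  exact isDivisorial_residual hr0 _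

/-- Factorization in the localization is by Noetherian induction on the contraction of the principal
ideal of x. These contractions are divisorial, and splitting off a nonunit factor enlarges them
strictly. -/
lemma IsMoriDomain.isLocallyLevel (h : IsMoriDomain D) (hL : IsLPVD D) : IsLocallyLevel D := by
  intro M hM
  have hwf := h.wellFoundedGT
  refine (hL.2 M).isStronglyPrime.isLevel ?_
  have key : ∀ I : {I : Ideal D // IsDivisorial I}, ∀ x : Localization.AtPrime M,
      x ∈ maximalIdeal (Localization.AtPrime M) → x ≠ 0 →
      (span {x}).comap (algebraMap D (Localization.AtPrime M)) = I.1 →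
      ∃ s : Multiset (Localization.AtPrime M), s.prod = x ∧ ∀ p ∈ s,
        p ∈ maximalIdeal (Localization.AtPrime M) ∧
        ∀ b ∈ maximalIdeal (Localization.AtPrime M),
          ∀ c ∈ maximalIdeal (Localization.AtPrime M), p ≠ b * c := by
    intro I
    induction I using hwf.wf.induction with
    | _ I ih =>
    intro x hx hx0 hxI
    by_cases hat : ∀ b ∈ maximalIdeal (Localization.AtPrime M),
        ∀ c ∈ maximalIdeal (Localization.AtPrime M), x ≠ b * c
    · exact ⟨{x}, by simp, by simpa using ⟨hx, hat⟩⟩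
    push Not at hat
    obtain ⟨b, hb, c, hc, rfl⟩ := hat
    have aux : ∀ b c : Localization.AtPrime M, c ∈ maximalIdeal (Localization.AtPrime M) →
        b ≠ 0 → (span {b * c}).comap (algebraMap D (Localization.AtPrime M)) <
          (span {b}).comap (algebraMap D (Localization.AtPrime M)) := by
      intro b c hc hb0
      refine lt_of_le_of_ne (comap_mono (span_singleton_le_span_singleton.mpr (dvd_mul_right b c)))
        fun heq => hb0 ?_
      have h1 := congrArg (Ideal.map (algebraMap D (Localization.AtPrime M))) heq
      rw [← under_def, ← under_def, IsLocalization.map_under M.primeCompl,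
        IsLocalization.map_under M.primeCompl] at h1
      refine eq_zero_of_mem_span_mul (x := b) ?_
      obtain ⟨r, hr⟩ := mem_span_singleton'.mp (h1 ▸ mem_span_singleton_self b)
      exact mem_span_singleton_mul.mpr ⟨r * c, mul_mem_left _ r hc, by linear_combination hr⟩
    have hb0 : b ≠ 0 := left_ne_zero_of_mul hx0
    have hc0 : c ≠ 0 := right_ne_zero_of_mul hx0
    obtain ⟨s, rfl, hs⟩ := ih ⟨_, h.isDivisorial_comap M hb0⟩ (by
      change I.1 < _
      rw [← hxI]; exact aux b c hc hb0) b hb hb0 rfl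
    obtain ⟨t, rfl, ht⟩ := ih ⟨_, h.isDivisorial_comap M hc0⟩ (by
      change I.1 < _
      rw [← hxI, mul_comm]; exact aux c _ hb hc0) c hc hc0 rfl
    refine ⟨s + t, by simp, fun p hp => ?_⟩
    rcases Multiset.mem_add.mp hp with hp | hp
    exacts [hs p hp, ht p hp]
  exact fun x hx hx0 => key ⟨_, h.isDivisorial_comap M hx0⟩ x hx hx0 rfl

/-- Locally, take c in m^k outside xD_M with m^(k+1) ⊆ xD_M; then xD_M : c is the maximal ideal. The
factor s carries this description back to D. -/
lemma IsMoriDomain.exists_eq_residual (h : IsMoriDomain D) (hL : IsLocallyLevel D) {M : Ideal D}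
    (hM : M.IsMaximal) {x : D} (hx : x ≠ 0) (hxM : x ∈ M) : ∃ d, M = residual x {d} := by
  classical
  set f := algebraMap D (Localization.AtPrime M)
  have hfm : ∀ x, f x ∈ maximalIdeal _ ↔ x ∈ M := fun x =>
    IsLocalization.AtPrime.to_map_mem_maximal_iff _ M x
  have hfx : f x ≠ 0 := fun h0 => hx
    (IsLocalization.injective _ M.primeCompl_le_nonZeroDivisors (by rw [h0, map_zero]))
  have hex := (hL M).exists_pow_le (I := span {f x}) (by simpa using hfx)
  obtain ⟨k, hk⟩ : ∃ k, Nat.find hex = k + 1 := by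
    refine Nat.exists_eq_succ_of_ne_zero fun h0 => ?_
    have h1 := Nat.find_spec hex
    rw [h0, pow_zero, one_eq_top, top_le_iff, span_singleton_eq_top] at h1
    exact (mem_maximalIdeal _).mp ((hfm x).mpr hxM) h1
  have hkx := Nat.find_spec hex
  rw [hk] at hkx
  obtain ⟨c, hc, hcx⟩ := SetLike.not_le_iff_exists.mp (Nat.find_min hex (by lia : k < Nat.find hex))
  obtain ⟨c', hcc⟩ := exists_associated_algebraMap M c
  have hc'x : f c' ∉ span {f x} := fun h => hcx (mem_of_dvd _ hcc.dvd' h)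
  have hc'k : f c' ∈ maximalIdeal _ ^ k := mem_of_dvd _ hcc.dvd hc
  obtain ⟨s, hs, hsx⟩ := h.exists_comap_span_eq M hx
  refine ⟨s * c', ?_⟩
  ext r
  have h1 : r ∈ residual x {s * c'} ↔ f c' * f r ∈ span {f x} := by
    rw [mem_residual_singleton, mul_assoc, ← mem_residual_singleton, ← hsx, mem_comap, map_mul]
  rw [h1]
  constructor
  · intro hr
    exact hkx (by rw [pow_succ]; exact mul_mem_mul hc'k ((hfm r).mpr hr))
  · intro hr
    by_contra hrM
    have hu : IsUnit (f r) := notMem_maximalIdeal.mp fun h => hrM ((hfm r).mp h)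
    exact hc'x ((mul_unit_mem_iff_mem _ hu).mp hr)

/-- For distinct maximal ideals M_j = xD : d_j containing x, the residuals xD : (M_0 ∩ ... ∩
M_(k-1)) ascend. Once they are stable at n, d_n belongs to the nth one, so M_0 ∩ ... ∩ M_(n-1) ⊆
M_n, which is impossible. -/
lemma IsMoriDomain.finite_isMaximal (h : IsMoriDomain D) (hL : IsLocallyLevel D) {x : D}
    (hx : x ≠ 0) : {M : Ideal D | M.IsMaximal ∧ x ∈ M}.Finite := by
  by_contra hinf
  have : Infinite {M : Ideal D | M.IsMaximal ∧ x ∈ M} := Set.infinite_coe_iff.mpr hinf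
  let e : ℕ ↪ {M : Ideal D | M.IsMaximal ∧ x ∈ M} := Infinite.natEmbedding _
  have hmax : ∀ k, (e k).1.IsMaximal := fun k => (e k).2.1
  choose d hd using fun k => h.exists_eq_residual hL (hmax k) hx (e k).2.2
  let N : ℕ → Ideal D := fun k => (Finset.range k).inf fun j => (e j).1
  have hN : Antitone N := fun i j hij => Finset.inf_mono (Finset.range_mono hij)
  obtain ⟨_, hM⟩ := h
  obtain ⟨n, hn⟩ := hM (fun k => residual x (N k))
    (fun i j hij r hr a ha => hr a (hN hij ha)) (fun k => isDivisorial_residual hx _)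
  have hdn : d n ∈ residual x (N (n + 1)) := by
    intro a ha
    have : a ∈ (e n).1 := (Finset.inf_le (f := fun j => (e j).1) (Finset.self_mem_range_succ n)) ha
    rw [hd n, mem_residual_singleton] at this
    rwa [mul_comm]
  rw [hn (n + 1) n.le_succ] at hdn
  have hle : N n ≤ (e n).1 := by
    intro a ha
    rw [hd n, mem_residual_singleton, mul_comm]
    exact hdn a ha
  obtain ⟨j, hj, hje⟩ := ((hmax n).isPrime.inf_le').mp hle
  have := e.injective (Subtype.ext ((hmax j).eq_of_le (hmax n).ne_top hje))
  simp [this] at hj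

lemma IsMoriDomain.finite_minimalPrimes (h : IsMoriDomain D) (hL : IsLocallyLevel D)
    (I : Ideal D) : I.minimalPrimes.Finite := by
  by_cases hI : I = ⊥
  · rw [hI, minimalPrimes_eq_subsingleton_self]
    exact Set.finite_singleton _
  · obtain ⟨x, hx, hx0⟩ := Submodule.exists_mem_ne_zero_of_ne_bot hI
    exact (h.finite_isMaximal hL hx0).subset fun P hP =>
      ⟨hL.isMaximal_of_mem hP.1.1 hx0 (hP.1.2 hx), hP.1.2 hx⟩

lemma IsMoriDomain.isTAFRing (h : IsMoriDomain D) (hL : IsLPVD D) : IsTAFRing D :=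
  (h.isLocallyLevel hL).isTAFRing (h.finite_minimalPrimes (h.isLocallyLevel hL))

end FromMori

/-- A ring with level localizations and finitely many minimal primes over each ideal decomposes into
atomic pseudo-valuation rings and Mori locally pseudo-valuation domains. -/
theorem IsLocallyLevel.exists_ringEquiv_pi {R : Type u} [CommRing R] [Nontrivial R]
    (h : IsLocallyLevel R) (hfin : ∀ I : Ideal R, I.minimalPrimes.Finite) :
    ∃ (r : ℕ) (S : Fin r → Type u) (_ : ∀ i, CommRing (S i)),
      0 < r ∧ Nonempty (R ≃+* ∀ i, S i) ∧
        ∀ i, (IsAtomicRing (S i) ∧ IsPVR (S i)) ∨ (IsMoriDomain (S i) ∧ IsLPVD (S i)) := by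
  have := (hfin ⊥).fintype
  have hne : Nonempty (⊥ : Ideal R).minimalPrimes := Ideal.nonempty_minimalPrimes bot_ne_top
  let e := Fintype.equivFin (⊥ : Ideal R).minimalPrimes
  let C : Fin (Fintype.card (⊥ : Ideal R).minimalPrimes) → Ideal R :=
    fun i => isolatedComponent ⊥ (e.symm i)
  have hinf : ⨅ i, C i = ⊥ :=
    (e.symm.iInf_comp (g := isolatedComponent ⊥)).trans (h.iInf_isolatedComponent ⊥)
  have hcop : Pairwise (Function.onFun IsCoprime C) := fun i j hij =>
    h.pairwise_isCoprime ⊥ (e.symm.injective.ne hij)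
  refine ⟨_, fun i => R ⧸ C i, fun i => inferInstance, Fintype.card_pos,
    ⟨(RingEquiv.quotientBot R).symm.trans ((Ideal.quotEquivOfEq hinf.symm).trans
      (Ideal.quotientInfRingEquivPiQuotient C hcop))⟩, fun i => ?_⟩
  by_cases hP : (e.symm i).1.IsMaximal
  · left
    obtain ⟨hloc, hlev⟩ := h.quotient_isolatedComponent (e.symm i) hP
    exact ⟨hlev.isAtomicRing, hlev.isPVR⟩
  · right
    have hprime : (C i).IsPrime := by
      change (isolatedComponent ⊥ (e.symm i)).IsPrime
      rw [isolatedComponent_eq_of_not_isMaximal h _ hP]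
      exact (e.symm i).2.1.1
    have hdom : IsDomain (R ⧸ C i) := Ideal.Quotient.isDomain (C i)
    have h1 : IsLocallyLevel (R ⧸ C i) := h.of_surjective Ideal.Quotient.mk_surjective
    exact ⟨h1.isMoriDomain (finite_minimalPrimes_of_surjective hfin Ideal.Quotient.mk_surjective),
      h1.isLPVD⟩

end TAF

theorem theorem4p3 (R : Type u) [CommRing R] [Nontrivial R] :
    List.TFAE [
      TAF.IsTAFRing R,
      TAF.IsStronglyLaskerian R ∧ ∀ M : Ideal R, M.IsMaximal →
        ∀ Q : Ideal R, Q.IsPrimary → Q.radical = M → Q ≤ M ^ 2 ∨ M ^ 2 ≤ Q,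
      TAF.IsStronglyLaskerian R ∧ TAF.IsLPVR R,
      TAF.IsFiniteAbsorbing R ∧ TAF.IsLPVR R,
      ∃ (r : ℕ) (S : Fin r → Type u) (_ : ∀ i, CommRing (S i)),
        0 < r ∧ Nonempty (R ≃+* ∀ i, S i) ∧
          ∀ i, (TAF.IsAtomicRing (S i) ∧ TAF.IsPVR (S i)) ∨
            (TAF.IsMoriDomain (S i) ∧ TAF.IsLPVD (S i))] := by
  tfae_have 1 → 2 := fun h =>
    ⟨h.isLocallyLevel.isStronglyLaskerian h.finite_minimalPrimes,
      fun M hM Q _ hQ => h.le_sq_or_sq_le hM hQ⟩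
  tfae_have 2 → 3 := fun h =>
    ⟨h.1, fun M hM => (h.1.isLevel_atPrime fun Q hQ hr => h.2 M hM Q hQ hr).isPVR⟩
  tfae_have 3 → 4 := fun h => ⟨h.1.isFiniteAbsorbing, h.2⟩
  tfae_have 4 → 5 := fun h =>
    (h.1.isLocallyLevel h.2).exists_ringEquiv_pi h.1.finite_minimalPrimes
  tfae_have 5 → 1 := by
    rintro ⟨r, S, _, -, ⟨e⟩, hS⟩
    refine TAF.IsTAFRing.of_surjective (f := (e.symm : (∀ i, S i) →+* R)) e.symm.surjective
      (TAF.IsTAFRing.pi fun i => ?_)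
    rcases hS i with ⟨ha, hp⟩ | ⟨hm, hl⟩
    · have := hp.isLocalRing
      exact (hp.isLevel_of_isAtomicRing ha).isTAFRing
    · have := hl.1
      exact hm.isTAFRing hl
  tfae_finish
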